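/- An $\omega$-globular set $X$ consists of sets $X_k$ ($k\in\mathbb N$) and maps $s,t\colon X_{k+1}\to X_k$ with $ss=st$ and $ts=tt$; morphisms are families of maps commuting with all $s$ and $t$. For $n\in\mathbb N$, $n$-globular sets are defined in the same way with $k\le n$ only. Write $\mathbf{Glob}_\omega$ and $\mathbf{Glob}_n$ for the resulting categories, $(-)_{\le n}\colon\mathbf{Glob}_\omega\to\mathbf{Glob}_n$ for truncation, $\iota_n\colon\mathbf{Glob}_n\to\mathbf{Glob}_\omega$ for its left adjoint, which extends an $n$-globular set by empty sets in dimensions $>n$, and $\varepsilon^n\colon\iota_n\bigl((-)_{\le n}\bigr)\Rightarrow\mathrm{id}$ for the counit. A monad $(T,\eta,\mu)$ on $\mathbf{Glob}_\omega$ is finitary if $T$ preserves directed (equivalently, filtered) colimits. It is weakly truncable if it is finitary and, for every $n\in\mathbb N$, the natural transformation $$\bigl(T(\varepsilon^n)\bigr)_{\le n}\colon\; T^n\bigl((-)_{\le n}\bigr)\Longrightarrow \bigl(T(-)\bigr)_{\le n},\qquad T^n=(-)_{\le n}\circ T\circ\iota_n,$$ is an isomorphism. For $i\le k$ write $s_i,t_i\colon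 X_k\to X_i$ for the iterated source and target maps. A strict $\omega$-category is an $\omega$-globular set $C$ with identity maps $1\colon C_k\to C_{k+1}$ and, for $i<k$, compositions $u*_iv\in C_k$ defined for $u,v\in C_k$ with $t_i(u)=s_i(v)$, such that: - $s(1_u)=t(1_u)=u$; - for $u,v\in C_k$ with $t_i(u)=s_i(v)$: if $i<k-1$, then $s(u*_iv)=s(u)*_is(v)$ and $t(u*_iv)=t(u)*_it(v)$; if $i=k-1$, then $s(u*_iv)=s(u)$ and $t(u*_iv)=t(v)$; - $1^k_{s_i(u)}*_iu=u=u*_i1^k_{t_i(u)}$ for $u\in C_k$ and $i<k$, where $1^k$ is the iterated identity $C_i\to C_k$; - $(u*_iv)*_iw=u*_i(v*_iw)$ whenever $t_i(u)=s_i(v)$ and $t_i(v)=s_i(w)$; - $1_{u*_iv}=1_u*_i1_v$ whenever $t_i(u)=s_i(v)$; - $(u*_iv)*_j(u'*_iv')=(u*_ju')*_i(v*_jv')$ for $i<j<k$ and $u,u',v,v'\in C_k$ with $t_i(u)=s_i(v)$, $t_j(u)=s_j(u')$ and $t_j(v)=s_j(v')$. Strict $\omega$-functors are morphisms of $\omega$-globular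 sets preserving identities and compositions; they form, with strict $\omega$-categories, the category $\mathbf{Cat}_\omega$. **Theorem.** The forgetful functor $U\colon\mathbf{Cat}_\omega\to\mathbf{Glob}_\omega$ has a left adjoint, and for every adjunction $F\dashv U$ the induced monad on $\mathbf{Glob}_\omega$ is (finitary and) weakly truncable. -/

import Mathlib

universe u

open CategoryTheory

/-- An `ω`-globular set: sets of `k`-globes for all `k`, with source and target maps satisfying
the globular identities. -/
structure OmegaGlob : Type (u + 1) where
  cell : ℕ → Type u
  src : ∀ {k : ℕ}, cell (k + 1) → cell k
  tgt : ∀ {k : ℕ}, cell (k + 1) → cell k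
  src_src : ∀ {k : ℕ} (x : cell (k + 2)), src (src x) = src (tgt x)
  tgt_src : ∀ {k : ℕ} (x : cell (k + 2)), tgt (src x) = tgt (tgt x)

namespace OmegaGlob

/-- Morphisms of `ω`-globular sets: families of maps commuting with sources and targets. -/
@[ext]
structure Hom (X Y : OmegaGlob.{u}) : Type u where
  map : ∀ k : ℕ, X.cell k → Y.cell k
  map_src : ∀ {k : ℕ} (x : X.cell (k + 1)), map k (X.src x) = Y.src (map (k + 1) x)
  map_tgt : ∀ {k : ℕ} (x : X.cell (k + 1)), map k (X.tgt x) = Y.tgt (map (k + 1) x)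

instance : Category.{u} OmegaGlob.{u} where
  Hom := Hom
  id X :=
    { map := fun _ x => x
      map_src := fun _ => rfl
      map_tgt := fun _ => rfl }
  comp f g :=
    { map := fun k x => g.map k (f.map k x)
      map_src := fun x => by rw [f.map_src, g.map_src]
      map_tgt := fun x => by rw [f.map_tgt, g.map_tgt] }

/-- The iterated source `cell k → cell i`, for `i ≤ k` (the identity when `i = k`). -/
def srcTo (X : OmegaGlob.{u}) {i k : ℕ} (h : i ≤ k) : X.cell k → X.cell i :=
  Nat.leRecOn (C := fun m => X.cell m → X.cell i) h (fun f x => f (X.src x)) (fun x => x)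

/-- The iterated target `cell k → cell i`, for `i ≤ k` (the identity when `i = k`). -/
def tgtTo (X : OmegaGlob.{u}) {i k : ℕ} (h : i ≤ k) : X.cell k → X.cell i :=
  Nat.leRecOn (C := fun m => X.cell m → X.cell i) h (fun f x => f (X.tgt x)) (fun x => x)

/-- Two `k`-globes are `i`-composable, for `i < k`, when the `i`-target of the first is the
`i`-source of the second. -/
def Composable (X : OmegaGlob.{u}) {i k : ℕ} (h : i < k) (x y : X.cell k) : Prop :=
  X.tgtTo h.le x = X.srcTo h.le y

end OmegaGlob

/-- An `n`-globular set, for a natural number `n`: sets of `k`-globes for `k ≤ n`, with source and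
target maps satisfying the globular identities. -/
structure FinGlob (n : ℕ) : Type (u + 1) where
  cell : ∀ k : ℕ, k ≤ n → Type u
  src : ∀ {k : ℕ} (h : k + 1 ≤ n), cell (k + 1) h → cell k (Nat.le_of_succ_le h)
  tgt : ∀ {k : ℕ} (h : k + 1 ≤ n), cell (k + 1) h → cell k (Nat.le_of_succ_le h)
  src_src : ∀ {k : ℕ} (h : k + 2 ≤ n) (x : cell (k + 2) h),
    src (Nat.le_of_succ_le h) (src h x) = src (Nat.le_of_succ_le h) (tgt h x)
  tgt_src : ∀ {k : ℕ} (h : k + 2 ≤ n) (x : cell (k + 2) h),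
    tgt (Nat.le_of_succ_le h) (src h x) = tgt (Nat.le_of_succ_le h) (tgt h x)

namespace FinGlob

/-- Morphisms of `n`-globular sets. -/
@[ext]
structure Hom {n : ℕ} (X Y : FinGlob.{u} n) : Type u where
  map : ∀ (k : ℕ) (h : k ≤ n), X.cell k h → Y.cell k h
  map_src : ∀ {k : ℕ} (h : k + 1 ≤ n) (x : X.cell (k + 1) h),
    map k (Nat.le_of_succ_le h) (X.src h x) = Y.src h (map (k + 1) h x)
  map_tgt : ∀ {k : ℕ} (h : k + 1 ≤ n) (x : X.cell (k + 1) h),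
    map k (Nat.le_of_succ_le h) (X.tgt h x) = Y.tgt h (map (k + 1) h x)

instance (n : ℕ) : Category.{u} (FinGlob.{u} n) where
  Hom := Hom
  id X :=
    { map := fun _ _ x => x
      map_src := fun _ _ => rfl
      map_tgt := fun _ _ => rfl }
  comp f g :=
    { map := fun k h x => g.map k h (f.map k h x)
      map_src := fun h x => by rw [f.map_src, g.map_src]
      map_tgt := fun h x => by rw [f.map_tgt, g.map_tgt] }

end FinGlob

namespace OmegaGlob

/-- The truncation functor, forgetting the globes of dimension greater than `n`. -/
def trunc (n : ℕ) : OmegaGlob.{u} ⥤ FinGlob.{u} n where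
  obj X :=
    { cell := fun k _ => X.cell k
      src := fun _ => X.src
      tgt := fun _ => X.tgt
      src_src := fun _ => X.src_src
      tgt_src := fun _ => X.tgt_src }
  map f :=
    { map := fun k _ => f.map k
      map_src := fun _ => f.map_src
      map_tgt := fun _ => f.map_tgt }

/-- The inclusion functor, extending an `n`-globular set by empty sets of globes in dimensions
greater than `n`: the type of `k`-globes below is empty unless `k ≤ n`, in which case it is the
original one. -/
def incl (n : ℕ) : FinGlob.{u} n ⥤ OmegaGlob.{u} where
  obj X :=
    { cell := fun k => Σ' h : k ≤ n, X.cell k h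
      src := fun x => ⟨Nat.le_of_succ_le x.1, X.src x.1 x.2⟩
      tgt := fun x => ⟨Nat.le_of_succ_le x.1, X.tgt x.1 x.2⟩
      src_src := fun x => by rw [X.src_src x.1 x.2]
      tgt_src := fun x => by rw [X.tgt_src x.1 x.2] }
  map f :=
    { map := fun k x => ⟨x.1, f.map k x.1 x.2⟩
      map_src := fun x => by rw [f.map_src x.1 x.2]
      map_tgt := fun x => by rw [f.map_tgt x.1 x.2] }

/-- The inclusion functor is left adjoint to the truncation functor. The counit is the canonical
morphism from the inclusion of the truncation of `X` to `X`. -/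
def inclTruncAdj (n : ℕ) : incl.{u} n ⊣ trunc.{u} n :=
  Adjunction.mkOfUnitCounit
    { unit :=
        { app := fun X =>
            { map := fun _ h x => ⟨h, x⟩
              map_src := fun _ _ => rfl
              map_tgt := fun _ _ => rfl } }
      counit :=
        { app := fun X =>
            { map := fun _ x => x.2
              map_src := fun _ => rfl
              map_tgt := fun _ => rfl } } }

/-- For a monad `T` on `ω`-globular sets, the underlying endofunctor of the induced monad on
`n`-globular sets: the composite of the inclusion, `T` and the truncation. -/
def truncEndo (T : Monad OmegaGlob.{u}) (n : ℕ) : FinGlob.{u} n ⥤ FinGlob.{u} n :=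
  incl n ⋙ T.toFunctor ⋙ trunc n

/-- The canonical comparison between truncating and then applying the induced monad on
`n`-globular sets, and applying `T` and then truncating. Its component at `X` is the truncation of
the image under `T` of the counit at `X`. -/
def truncComparison (T : Monad OmegaGlob.{u}) (n : ℕ) :
    trunc n ⋙ truncEndo T n ⟶ T.toFunctor ⋙ trunc n where
  app X := (trunc n).map (T.map ((inclTruncAdj n).counit.app X))
  naturality X Y f := by
    have h := (inclTruncAdj n).counit.naturality f
    simp only [Functor.comp_map, Functor.id_map] at h
    simp only [truncEndo, Functor.comp_map]
    rw [← Functor.map_comp, ← Functor.map_comp, ← Functor.map_comp, ← Functor.map_comp, h]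

/-- A monad on `ω`-globular sets is weakly truncable when all its comparisons are natural
isomorphisms. -/
def IsWeaklyTruncable (T : Monad OmegaGlob.{u}) : Prop :=
  ∀ n : ℕ, IsIso (truncComparison T n)

/-- A monad on `ω`-globular sets is finitary when its endofunctor preserves filtered
(equivalently, directed) colimits. -/
def IsFinitary (T : Monad OmegaGlob.{u}) : Prop :=
  Limits.PreservesFilteredColimits T.toFunctor

end OmegaGlob

/-- A strict `ω`-category: an `ω`-globular set with identities `ident : cell k → cell (k + 1)` and,
for `i < k`, compositions of `i`-composable `k`-cells.

Whenever an axiom mentions a composite whose arguments are composable only because of other axioms,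
the axiom is stated for an arbitrary proof of that composability; such a proof always exists. -/
structure StrictOmegaCat : Type (u + 1) extends OmegaGlob.{u} where
  ident : ∀ {k : ℕ}, cell k → cell (k + 1)
  comp : ∀ {i k : ℕ} (h : i < k) (x y : cell k), toOmegaGlob.Composable h x y → cell k
  src_ident : ∀ {k : ℕ} (x : cell k), src (ident x) = x
  tgt_ident : ∀ {k : ℕ} (x : cell k), tgt (ident x) = x
  src_comp : ∀ {i k : ℕ} (h : i < k) (x y : cell (k + 1))
    (hxy : toOmegaGlob.Composable (Nat.lt_succ_of_lt h) x y)
    (hxy' : toOmegaGlob.Composable h (src x) (src y)),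
    src (comp (Nat.lt_succ_of_lt h) x y hxy) = comp h (src x) (src y) hxy'
  tgt_comp : ∀ {i k : ℕ} (h : i < k) (x y : cell (k + 1))
    (hxy : toOmegaGlob.Composable (Nat.lt_succ_of_lt h) x y)
    (hxy' : toOmegaGlob.Composable h (tgt x) (tgt y)),
    tgt (comp (Nat.lt_succ_of_lt h) x y hxy) = comp h (tgt x) (tgt y) hxy'
  src_comp_self : ∀ {k : ℕ} (x y : cell (k + 1))
    (hxy : toOmegaGlob.Composable (Nat.lt_succ_self k) x y),
    src (comp (Nat.lt_succ_self k) x y hxy) = src x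
  tgt_comp_self : ∀ {k : ℕ} (x y : cell (k + 1))
    (hxy : toOmegaGlob.Composable (Nat.lt_succ_self k) x y),
    tgt (comp (Nat.lt_succ_self k) x y hxy) = tgt y
  /-- Left unit: `Nat.leRecOn h.le ident` is the iterated identity `cell i → cell k`. -/
  id_comp : ∀ {i k : ℕ} (h : i < k) (x : cell k)
    (hx : toOmegaGlob.Composable h (Nat.leRecOn h.le ident (toOmegaGlob.srcTo h.le x)) x),
    comp h (Nat.leRecOn h.le ident (toOmegaGlob.srcTo h.le x)) x hx = x
  /-- Right unit. -/
  comp_id : ∀ {i k : ℕ} (h : i < k) (x : cell k)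
    (hx : toOmegaGlob.Composable h x (Nat.leRecOn h.le ident (toOmegaGlob.tgtTo h.le x))),
    comp h x (Nat.leRecOn h.le ident (toOmegaGlob.tgtTo h.le x)) hx = x
  assoc : ∀ {i k : ℕ} (h : i < k) (x y z : cell k)
    (hxy : toOmegaGlob.Composable h x y) (hyz : toOmegaGlob.Composable h y z)
    (hl : toOmegaGlob.Composable h (comp h x y hxy) z)
    (hr : toOmegaGlob.Composable h x (comp h y z hyz)),
    comp h (comp h x y hxy) z hl = comp h x (comp h y z hyz) hr
  ident_comp : ∀ {i k : ℕ} (h : i < k) (x y : cell k) (hxy : toOmegaGlob.Composable h x y)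
    (hxy' : toOmegaGlob.Composable (Nat.lt_succ_of_lt h) (ident x) (ident y)),
    ident (comp h x y hxy) = comp (Nat.lt_succ_of_lt h) (ident x) (ident y) hxy'
  /-- The exchange law. -/
  exchange : ∀ {i j k : ℕ} (hij : i < j) (hjk : j < k) (x x' y y' : cell k)
    (hxy : toOmegaGlob.Composable (hij.trans hjk) x y)
    (hxx' : toOmegaGlob.Composable hjk x x')
    (hyy' : toOmegaGlob.Composable hjk y y')
    (hxy' : toOmegaGlob.Composable (hij.trans hjk) x' y')
    (hl : toOmegaGlob.Composable hjk
      (comp (hij.trans hjk) x y hxy) (comp (hij.trans hjk) x' y' hxy'))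
    (hr : toOmegaGlob.Composable (hij.trans hjk) (comp hjk x x' hxx') (comp hjk y y' hyy')),
    comp hjk (comp (hij.trans hjk) x y hxy) (comp (hij.trans hjk) x' y' hxy') hl =
      comp (hij.trans hjk) (comp hjk x x' hxx') (comp hjk y y' hyy') hr

namespace StrictOmegaCat

/-- Strict `ω`-functors: morphisms of `ω`-globular sets preserving identities and compositions. -/
@[ext]
structure Hom (C D : StrictOmegaCat.{u}) : Type u
    extends OmegaGlob.Hom C.toOmegaGlob D.toOmegaGlob where
  map_ident : ∀ {k : ℕ} (x : C.cell k), map (k + 1) (C.ident x) = D.ident (map k x)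
  map_comp : ∀ {i k : ℕ} (h : i < k) (x y : C.cell k)
    (hxy : C.toOmegaGlob.Composable h x y)
    (hxy' : D.toOmegaGlob.Composable h (map k x) (map k y)),
    map k (C.comp h x y hxy) = D.comp h (map k x) (map k y) hxy'

end StrictOmegaCat

/-- Morphisms of `ω`-globular sets commute with iterated sources. -/
theorem OmegaGlob.Hom.map_srcTo {X Y : OmegaGlob.{u}} (f : OmegaGlob.Hom X Y) {i k : ℕ}
    (h : i ≤ k) (x : X.cell k) : f.map i (X.srcTo h x) = Y.srcTo h (f.map k x) := by
  induction k, h using Nat.le_induction with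
  | base => simp only [OmegaGlob.srcTo, Nat.leRecOn_self]
  | succ k h ih =>
    simp only [OmegaGlob.srcTo, Nat.leRecOn_succ h] at ih ⊢
    rw [ih, f.map_src]

/-- Morphisms of `ω`-globular sets commute with iterated targets. -/
theorem OmegaGlob.Hom.map_tgtTo {X Y : OmegaGlob.{u}} (f : OmegaGlob.Hom X Y) {i k : ℕ}
    (h : i ≤ k) (x : X.cell k) : f.map i (X.tgtTo h x) = Y.tgtTo h (f.map k x) := by
  induction k, h using Nat.le_induction with
  | base => simp only [OmegaGlob.tgtTo, Nat.leRecOn_self]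
  | succ k h ih =>
    simp only [OmegaGlob.tgtTo, Nat.leRecOn_succ h] at ih ⊢
    rw [ih, f.map_tgt]

/-- Morphisms of `ω`-globular sets preserve composability. -/
theorem OmegaGlob.Hom.map_composable {X Y : OmegaGlob.{u}} (f : OmegaGlob.Hom X Y) {i k : ℕ}
    (h : i < k) {x y : X.cell k} (hxy : X.Composable h x y) :
    Y.Composable h (f.map k x) (f.map k y) := by
  unfold OmegaGlob.Composable at *
  rw [← f.map_tgtTo, ← f.map_srcTo, hxy]

namespace StrictOmegaCat

instance : Category.{u} StrictOmegaCat.{u} where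
  Hom := Hom
  id C :=
    { toHom := 𝟙 C.toOmegaGlob
      map_ident := fun _ => rfl
      map_comp := fun _ _ _ _ _ => rfl }
  comp {C D E} f g :=
    { toHom := (show C.toOmegaGlob ⟶ D.toOmegaGlob from f.toHom) ≫ g.toHom
      map_ident := fun x =>
        (congrArg (g.map _) (f.map_ident x)).trans (g.map_ident (f.map _ x))
      map_comp := fun h x y hxy hxy' =>
        (congrArg (g.map _) (f.map_comp h x y hxy (f.toHom.map_composable h hxy))).trans
          (g.map_comp h (f.map _ x) (f.map _ y) (f.toHom.map_composable h hxy) hxy') }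

/-- The forgetful functor from strict `ω`-categories to `ω`-globular sets. -/
def forget : StrictOmegaCat.{u} ⥤ OmegaGlob.{u} where
  obj C := C.toOmegaGlob
  map f := f.toHom

end StrictOmegaCat

/-! The free strict ω-category is built from syntax. A formal composite (`PreCell`) is a tree of
generators, identities and compositions, subject to no composability condition. One inductive
relation `Eqv` is at once well-formedness (`Eqv x x`) and provable equality, and cells are classes
of well-formed composites. Composability refers to formal faces, so faces must respect `Eqv` and
satisfy the globular identities; this is `faceCompat`, by induction on dimension. The universal
property holds because provably equal composites have the same value in every strict ω-category
(`Eqv.exists_eval`) and because the operations generate all cells (`free_hom_ext`).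

Finitarity and truncability come from one observation. A composite of dimension `k`, or a derivation
of `Eqv` in dimension `k`, involves finitely many generators, all of dimension at most `k`, since no
premise of a rule has higher dimension than its conclusion. Hence a cocone that looks like a
filtered colimit in degrees at most `n` still does so after applying the free functor
(`FilteredUpTo.free`). Using this for all `n` gives preservation of filtered colimits; using it for
a one-object diagram and the counit, bijective in degrees at most `n`, gives truncability.
Uniqueness of left adjoints transports both to any `F`. -/

/-- Iterate a family of maps lowering the degree by one. -/
def descend {A : ℕ → Type*} (d : ∀ {k : ℕ}, A (k + 1) → A k) {i k : ℕ} (h : i ≤ k) : A k → A i :=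
  Nat.leRecOn (C := fun m => A m → A i) h (fun f x => f (d x)) (fun x => x)

section descend

variable {A B : ℕ → Type*} (d : ∀ {k : ℕ}, A (k + 1) → A k) (e : ∀ {k : ℕ}, B (k + 1) → B k)

@[simp]
theorem descend_self {k : ℕ} (h : k ≤ k) (x : A k) : descend d h x = x := by
  simp only [descend, Nat.leRecOn_self]

theorem descend_succ {i k : ℕ} (h : i ≤ k) (h' : i ≤ k + 1) (x : A (k + 1)) :
    descend d h' x = descend d h (d x) := by
  simp only [descend, Nat.leRecOn_succ h]

/-- The relation is a parameter because it is later `Eqv`, `Eval` or the graph of `map`.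
Preservation is required only up to degree `k`, which allows use inside an induction on dimension.
-/
theorem descend_rel (R : ∀ {k : ℕ}, A k → B k → Prop) {i k : ℕ} (h : i ≤ k)
    (hR : ∀ {m : ℕ} {x : A (m + 1)} {y : B (m + 1)}, m < k → R x y → R (d x) (e y))
    {x : A k} {y : B k} (hxy : R x y) : R (descend d h x) (descend e h y) := by
  induction k, h using Nat.le_induction with
  | base => simpa using hxy
  | succ k h ih =>
    rw [descend_succ d h, descend_succ e h]
    exact ih (fun hm => hR (hm.trans k.lt_succ_self)) (hR k.lt_succ_self hxy)

end descend

/-! ### Formal composites and their provable equality -/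

namespace OmegaGlob

/-- The target of a globe if `b` is true, the source otherwise. -/
def face (X : OmegaGlob.{u}) (b : Bool) {k : ℕ} (x : X.cell (k + 1)) : X.cell k :=
  if b then X.tgt x else X.src x

theorem face_face (X : OmegaGlob.{u}) (a b c : Bool) {k : ℕ} (x : X.cell (k + 2)) :
    X.face a (X.face b x) = X.face a (X.face c x) := by
  cases a <;> cases b <;> cases c <;> simp [face, X.src_src, X.tgt_src]

theorem Hom.map_face {X Y : OmegaGlob.{u}} (f : Hom X Y) (b : Bool) {k : ℕ}
    (x : X.cell (k + 1)) : f.map k (X.face b x) = Y.face b (f.map (k + 1) x) := by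
  cases b
  · exact f.map_src x
  · exact f.map_tgt x

/-- Formal composites of globes and identities, without any condition of composability. -/
inductive PreCell (X : OmegaGlob.{u}) : ℕ → Type u
  | gen {k : ℕ} (x : X.cell k) : PreCell X k
  | ident {k : ℕ} (x : PreCell X k) : PreCell X (k + 1)
  | comp {i k : ℕ} (h : i < k) (x y : PreCell X k) : PreCell X k

namespace PreCell

variable {X Y Z : OmegaGlob.{u}}

/-- The formal target of a formal composite if `b` is true, the formal source otherwise. -/
def face (b : Bool) : ∀ {k : ℕ}, PreCell X (k + 1) → PreCell X k
  | _, gen x => gen (X.face b x)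
  | _, ident x => x
  | k, comp (i := i) _ x y =>
    if h : i < k then comp h (face b x) (face b y) else if b then face b y else face b x

@[simp]
theorem face_gen (b : Bool) {k : ℕ} (x : X.cell (k + 1)) : face b (gen x) = gen (X.face b x) := by
  rw [face]

@[simp]
theorem face_ident (b : Bool) {k : ℕ} (x : PreCell X k) : face b (ident x) = x := by
  rw [face]

theorem face_comp_of_lt (b : Bool) {i k : ℕ} (h : i < k) (h' : i < k + 1)
    (x y : PreCell X (k + 1)) : face b (comp h' x y) = comp h (face b x) (face b y) := by
  rw [face, dif_pos h]

theorem face_comp_self (b : Bool) {k : ℕ} (h : k < k + 1) (x y : PreCell X (k + 1)) :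
    face b (comp h x y) = if b then face b y else face b x := by
  rw [face, dif_neg (lt_irrefl k)]

/-- The iterated formal target or source. -/
def faceTo (b : Bool) {i k : ℕ} (h : i ≤ k) : PreCell X k → PreCell X i :=
  descend (face b) h

/-- The iterated formal identity. -/
def identTo {i k : ℕ} (h : i ≤ k) (x : PreCell X i) : PreCell X k :=
  Nat.leRecOn h ident x

@[simp]
theorem faceTo_self (b : Bool) {k : ℕ} (h : k ≤ k) (x : PreCell X k) : faceTo b h x = x :=
  descend_self _ h x

theorem faceTo_succ (b : Bool) {i k : ℕ} (h : i ≤ k) (h' : i ≤ k + 1) (x : PreCell X (k + 1)) :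
    faceTo b h' x = faceTo b h (face b x) :=
  descend_succ _ h h' x

@[simp]
theorem identTo_self {k : ℕ} (h : k ≤ k) (x : PreCell X k) : identTo h x = x :=
  Nat.leRecOn_self x

theorem identTo_succ {i k : ℕ} (h : i ≤ k) (h' : i ≤ k + 1) (x : PreCell X i) :
    identTo h' x = ident (identTo h x) :=
  Nat.leRecOn_succ h x

/-- The pairs of formal composites which the axioms of strict `ω`-categories identify. -/
inductive Ax : ∀ {k : ℕ}, PreCell X k → PreCell X k → Prop
  -- The cell `a` is arbitrary rather than the source of `x`: well-formedness of the composite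
  -- already forces it to be equivalent to that source, and below the top index a face of an
  -- instance is then again an instance with the same `a`.
  | id_comp {i k : ℕ} (h : i < k) (a : PreCell X i) (x : PreCell X k) :
    Ax (comp h (identTo h.le a) x) x
  | comp_id {i k : ℕ} (h : i < k) (a : PreCell X i) (x : PreCell X k) :
    Ax (comp h x (identTo h.le a)) x
  | assoc {i k : ℕ} (h : i < k) (x y z : PreCell X k) :
    Ax (comp h (comp h x y) z) (comp h x (comp h y z))
  | ident_comp {i k : ℕ} (h : i < k) (x y : PreCell X k) :
    Ax (ident (comp h x y)) (comp (Nat.lt_succ_of_lt h) (ident x) (ident y))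
  | exchange {i j k : ℕ} (hij : i < j) (hjk : j < k) (x x' y y' : PreCell X k) :
    Ax (comp hjk (comp (hij.trans hjk) x y) (comp (hij.trans hjk) x' y'))
      (comp (hij.trans hjk) (comp hjk x x') (comp hjk y y'))

/-- The partial equivalence relation of being well-formed and equal in every strict
`ω`-category. -/
inductive Eqv : ∀ {k : ℕ}, PreCell X k → PreCell X k → Prop
  | gen {k : ℕ} (x : X.cell k) : Eqv (gen x) (gen x)
  | symm {k : ℕ} {x y : PreCell X k} (h : Eqv x y) : Eqv y x
  | trans {k : ℕ} {x y z : PreCell X k} (h : Eqv x y) (h' : Eqv y z) : Eqv x z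
  | ident {k : ℕ} {x y : PreCell X k} (h : Eqv x y) : Eqv (ident x) (ident y)
  -- The second composability premise follows from the first once faces respect `Eqv`, but that fact
  -- is itself proved by induction on these derivations.
  | comp {i k : ℕ} (h : i < k) {x x' y y' : PreCell X k} (hx : Eqv x x') (hy : Eqv y y')
    (hxy : Eqv (faceTo true h.le x) (faceTo false h.le y))
    (hxy' : Eqv (faceTo true h.le x') (faceTo false h.le y')) : Eqv (comp h x y) (comp h x' y')
  | ax {k : ℕ} {x y : PreCell X k} (h : Ax x y) (hx : Eqv x x) (hy : Eqv y y) : Eqv x y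

theorem Eqv.left {k : ℕ} {x y : PreCell X k} (h : Eqv x y) : Eqv x x := h.trans h.symm

theorem Eqv.right {k : ℕ} {x y : PreCell X k} (h : Eqv x y) : Eqv y y := h.symm.trans h

/-- Well-formedness in terms of the outermost operation. -/
def SubWF : ∀ {k : ℕ}, PreCell X k → Prop
  | _, gen _ => True
  | _, ident x => Eqv x x
  | _, comp h x y => Eqv x x ∧ Eqv y y ∧ Eqv (faceTo true h.le x) (faceTo false h.le y)

/-- Symmetry and transitivity make case analysis on `Eqv x x` useless. Induction works because every
rule carries the well-formedness of the immediate subterms of both sides; `ax` does so by assuming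
both sides well-formed. -/
theorem Eqv.subWF {k : ℕ} {x y : PreCell X k} (h : Eqv x y) : SubWF x ∧ SubWF y := by
  induction h with
  | gen x => exact ⟨trivial, trivial⟩
  | symm _ ih => exact ih.symm
  | trans _ _ ih ih' => exact ⟨ih.1, ih'.2⟩
  | ident h => exact ⟨h.left, h.right⟩
  | comp h hx hy hxy hxy' => exact ⟨⟨hx.left, hy.left, hxy⟩, ⟨hx.right, hy.right, hxy'⟩⟩
  | ax _ _ _ ih ih' => exact ⟨ih.1, ih'.1⟩

theorem face_identTo (b : Bool) {i k : ℕ} (h : i ≤ k) (h' : i ≤ k + 1) (x : PreCell X i) :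
    face b (identTo h' x) = identTo h x := by
  rw [identTo_succ h h', face_ident]

theorem faceTo_identTo (b : Bool) {i k : ℕ} (h : i ≤ k) (x : PreCell X i) :
    faceTo b h (identTo h x) = x := by
  induction k, h using Nat.le_induction with
  | base => simp
  | succ k h ih => rw [faceTo_succ b h, face_identTo b h, ih]

/-- Below the top index, a face of an axiom is the same axiom one dimension lower. At the top index
a face of a composite is a face of one factor and the two sides coincide, except for one face in
each unit law: there `a` must be compared with a face of `x`, which is the composability condition
contained in `hx`. -/
theorem Ax.face_eqv (b : Bool) {k : ℕ} {x y : PreCell X (k + 1)} (h : Ax x y) (hx : Eqv x x)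
    (hx' : Eqv (face b x) (face b x)) (hy' : Eqv (face b y) (face b y)) :
    Eqv (face b x) (face b y) := by
  cases h with
  | @id_comp i _ h a x =>
    rcases Nat.lt_succ_iff_lt_or_eq.1 h with h' | rfl
    · rw [face_comp_of_lt b h', face_identTo b h'.le] at *
      exact .ax (.id_comp h' _ _) hx' hy'
    · have := hx.subWF.1.2.2
      rw [faceTo_identTo, faceTo_succ _ le_rfl, faceTo_self] at this
      rw [face_comp_self] at *
      cases b
      · simpa [face_identTo _ le_rfl] using this
      · simpa using hy'
  | @comp_id i _ h a x =>
    rcases Nat.lt_succ_iff_lt_or_eq.1 h with h' | rfl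
    · rw [face_comp_of_lt b h', face_identTo b h'.le] at *
      exact .ax (.comp_id h' _ _) hx' hy'
    · have := hx.subWF.1.2.2
      rw [faceTo_identTo, faceTo_succ _ le_rfl, faceTo_self] at this
      rw [face_comp_self] at *
      cases b
      · simpa using hy'
      · simpa [face_identTo _ le_rfl] using this.symm
  | @assoc i _ h x y z =>
    rcases Nat.lt_succ_iff_lt_or_eq.1 h with h' | rfl
    · simp only [face_comp_of_lt b h'] at *
      exact .ax (.assoc h' _ _ _) hx' hy'
    · simp only [face_comp_self] at *
      cases b <;> simpa using hx'
  | @ident_comp i _ h x y =>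
    rw [face_comp_of_lt b h] at *
    simpa using hx'
  | @exchange i j _ hij hjk x x' y y' =>
    rcases Nat.lt_succ_iff_lt_or_eq.1 hjk with h' | rfl
    · simp only [face_comp_of_lt b h', face_comp_of_lt b (hij.trans h')] at *
      exact .ax (.exchange hij h' _ _ _ _) hx' hy'
    · simp only [face_comp_of_lt b hij, face_comp_self] at *
      cases b <;> simpa using hx'

/-- Formal faces preserve the relation. -/
def FaceCongr : ∀ {k : ℕ}, PreCell X k → PreCell X k → Prop
  | 0, _, _ => True
  | _ + 1, x, y => ∀ b, Eqv (face b x) (face b y)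

/-- The globular identities hold. -/
def Globular : ∀ {k : ℕ}, PreCell X k → Prop
  | 0, _ => True
  | 1, _ => True
  | _ + 2, x => ∀ a b c, Eqv (face a (face b x)) (face a (face c x))

end PreCell
end OmegaGlob

/-! ### Compatibility of provable equality with faces -/

namespace OmegaGlob
namespace PreCell

variable {X Y Z : OmegaGlob.{u}}

/-- The relation is compatible with formal faces in degree `k`. -/
def FaceCompat (X : OmegaGlob.{u}) (k : ℕ) : Prop :=
  ∀ x y : PreCell X k, Eqv x y → FaceCongr x y ∧ Globular x ∧ Globular y

theorem FaceCompat.faceTo {k : ℕ} (H : ∀ m ≤ k, FaceCompat X m) (b : Bool) {i : ℕ} (h : i ≤ k)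
    {x y : PreCell X k} (hxy : Eqv x y) : Eqv (faceTo b h x) (faceTo b h y) :=
  descend_rel (face b) (face b) (fun x y => Eqv x y) h
    (fun hm hxy => (H _ (Nat.succ_le_of_lt hm) _ _ hxy).1 b) hxy

/-- Globularity trades the first face `c` for `b`, and compatibility in lower degrees carries this
through the remaining faces. Strictness of `i < k` leaves at least one face after the first. -/
theorem FaceCompat.faceTo_face {k : ℕ} (H : ∀ m ≤ k, FaceCompat X m) (b c : Bool) {i : ℕ}
    (h : i < k) (h' : i ≤ k + 1) {x : PreCell X (k + 1)} (hx : Globular x) :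
    Eqv (PreCell.faceTo b h.le (face c x)) (PreCell.faceTo b h' x) := by
  obtain ⟨k, rfl⟩ := Nat.exists_eq_add_one_of_ne_zero (Nat.ne_zero_of_lt h)
  rw [faceTo_succ b h.le h', faceTo_succ b (Nat.lt_succ_iff.1 h),
    faceTo_succ b (Nat.lt_succ_iff.1 h)]
  exact FaceCompat.faceTo (fun m hm => H m (hm.trans k.le_succ)) b _ (hx b c b)

theorem FaceCompat.composable_face {k : ℕ} (H : ∀ m ≤ k, FaceCompat X m) (b : Bool) {i : ℕ}
    (h : i < k) (h' : i ≤ k + 1) {x y : PreCell X (k + 1)} (hx : Globular x) (hy : Globular y)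
    (hxy : Eqv (PreCell.faceTo true h' x) (PreCell.faceTo false h' y)) :
    Eqv (PreCell.faceTo true h.le (face b x)) (PreCell.faceTo false h.le (face b y)) :=
  ((FaceCompat.faceTo_face H true b h h' hx).trans hxy).trans
    (FaceCompat.faceTo_face H false b h h' hy).symm

theorem FaceCompat.faceCongr_comp {i k : ℕ} (H : ∀ m < k, FaceCompat X m) (h : i < k)
    {x x' y y' : PreCell X k} (hxg : Globular x) (hxg' : Globular x') (hyg : Globular y)
    (hyg' : Globular y') (hx : FaceCongr x x') (hy : FaceCongr y y')
    (hxy : Eqv (PreCell.faceTo true h.le x) (PreCell.faceTo false h.le y))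
    (hxy' : Eqv (PreCell.faceTo true h.le x') (PreCell.faceTo false h.le y')) :
    FaceCongr (comp h x y) (comp h x' y') := by
  obtain ⟨k, rfl⟩ := Nat.exists_eq_add_one_of_ne_zero (Nat.ne_zero_of_lt h)
  intro b
  have H' : ∀ m ≤ k, FaceCompat X m := fun m hm => H m (Nat.lt_succ_of_le hm)
  rcases Nat.lt_succ_iff_lt_or_eq.1 h with h' | rfl
  · rw [face_comp_of_lt b h', face_comp_of_lt b h']
    exact .comp h' (hx b) (hy b) (FaceCompat.composable_face H' b h' _ hxg hyg hxy)
      (FaceCompat.composable_face H' b h' _ hxg' hyg' hxy')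
  · rw [face_comp_self, face_comp_self]
    cases b
    · exact hx _
    · exact hy _

/-- When `i` is the top index, the two inner faces may come from different factors; the
composability equivalence, one dimension lower, joins them. Otherwise the globular identities of the
factors suffice, with composability passing to faces. -/
theorem FaceCompat.globular_comp {i k : ℕ} (H : ∀ m < k, FaceCompat X m) (h : i < k)
    {x y : PreCell X k} (hxg : Globular x) (hyg : Globular y) (hx : FaceCongr x x)
    (hy : FaceCongr y y)
    (hxy : Eqv (PreCell.faceTo true h.le x) (PreCell.faceTo false h.le y)) :
    Globular (comp h x y) := by
  match k with
  | 0 => trivial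
  | 1 => trivial
  | k + 2 =>
    intro a b c
    have H' : ∀ m ≤ k + 1, FaceCompat X m := fun m hm => H m (Nat.lt_succ_of_le hm)
    have H'' : ∀ m ≤ k, FaceCompat X m := fun m hm => H' m (hm.trans k.le_succ)
    rcases Nat.lt_succ_iff_lt_or_eq.1 h with h' | rfl
    · rw [face_comp_of_lt b h', face_comp_of_lt c h']
      rcases Nat.lt_succ_iff_lt_or_eq.1 h' with h'' | rfl
      · rw [face_comp_of_lt a h'', face_comp_of_lt a h'']
        have key : ∀ b, Eqv (PreCell.faceTo true h''.le (face a (face b x)))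
            (PreCell.faceTo false h''.le (face a (face b y))) := fun b =>
          FaceCompat.composable_face H'' a h'' _ (H' _ le_rfl _ _ (hx b)).2.1
            (H' _ le_rfl _ _ (hy b)).2.1 (FaceCompat.composable_face H' b h' h.le hxg hyg hxy)
        exact .comp h'' (hxg a b c) (hyg a b c) (key b) (key c)
      · rw [face_comp_self, face_comp_self]
        cases a
        · exact hxg _ _ _
        · exact hyg _ _ _
    · rw [faceTo_succ _ le_rfl, faceTo_succ _ le_rfl, faceTo_self, faceTo_self] at hxy
      have key := (H' _ le_rfl _ _ hxy).1 a
      rw [face_comp_self, face_comp_self]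
      cases b <;> cases c
      · exact hxg _ _ _
      · exact ((hxg a _ _).trans key).trans (hyg a _ _)
      · exact (((hxg a _ _).trans key).trans (hyg a _ _)).symm
      · exact hyg _ _ _

/-- Faces and globularity have to be proved together: the faces of a composite are composable only
because the factors are globular. Iterated faces are handled by the induction on dimension, the
immediate premises by induction on the derivation. -/
theorem faceCompat (X : OmegaGlob.{u}) (k : ℕ) : FaceCompat X k := by
  induction k using Nat.strong_induction_on with
  | _ N H =>
    intro x y hxy
    -- A derivation may pass through lower dimensions, so the inner induction covers all `k ≤ N`.
    suffices ∀ k (x y : PreCell X k), Eqv x y → k ≤ N →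
        FaceCongr x y ∧ Globular x ∧ Globular y from this N x y hxy le_rfl
    intro k x y hxy
    induction hxy with
    | @gen k x =>
      intro _
      have hg : Globular (gen x) := by
        match k with
        | 0 => trivial
        | 1 => trivial
        | k + 2 =>
          intro a b c
          simp only [face_gen, X.face_face a b c]
          exact .gen _
      refine ⟨?_, hg, hg⟩
      match k with
      | 0 => trivial
      | k + 1 =>
        intro b
        rw [face_gen]
        exact .gen _
    | @symm k x y _ ih =>
      intro hk
      obtain ⟨h, hx, hy⟩ := ih hk
      refine ⟨?_, hy, hx⟩
      match k with
      | 0 => trivial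
      | k + 1 => exact fun b => (h b).symm
    | @trans k x y z _ _ ih ih' =>
      intro hk
      obtain ⟨h, hx, _⟩ := ih hk
      obtain ⟨h', _, hz⟩ := ih' hk
      refine ⟨?_, hx, hz⟩
      match k with
      | 0 => trivial
      | k + 1 => exact fun b => (h b).trans (h' b)
    | @ident k x y h ih =>
      intro hk
      have key : ∀ x : PreCell X k, Eqv x x → Globular (PreCell.ident x) := fun x hx => by
        have hx' := (H k (Nat.lt_of_succ_le hk) x x hx).1
        match k with
        | 0 => trivial
        | k + 1 =>
          intro a b c
          rw [face_ident, face_ident]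
          exact hx' a
      refine ⟨fun b => ?_, key x h.left, key y h.right⟩
      rw [face_ident, face_ident]
      exact h
    | @comp i k h x x' y y' hx hy hxy hxy' ihx ihy _ _ =>
      intro hk
      have H' : ∀ m < k, FaceCompat X m := fun m hm => H m (hm.trans_le hk)
      obtain ⟨hxc, hxg, hxg'⟩ := ihx hk
      obtain ⟨hyc, hyg, hyg'⟩ := ihy hk
      have key : ∀ {x y : PreCell X k}, FaceCongr x y → FaceCongr x x ∧ FaceCongr y y :=
        fun {x y} h => by
          match k with
          | 0 => exact ⟨trivial, trivial⟩
          | k + 1 => exact ⟨fun b => (h b).left, fun b => (h b).right⟩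
      exact ⟨FaceCompat.faceCongr_comp H' h hxg hxg' hyg hyg' hxc hyc hxy hxy',
        FaceCompat.globular_comp H' h hxg hyg (key hxc).1 (key hyc).1 hxy,
        FaceCompat.globular_comp H' h hxg' hyg' (key hxc).2 (key hyc).2 hxy'⟩
    | @ax k x y h hx _ ihx ihy =>
      intro hk
      obtain ⟨hxc, hxg, _⟩ := ihx hk
      obtain ⟨hyc, hyg, _⟩ := ihy hk
      refine ⟨?_, hxg, hyg⟩
      match k with
      | 0 => trivial
      | k + 1 => exact fun b => h.face_eqv b hx (hxc b) (hyc b)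

theorem Eqv.face (b : Bool) {k : ℕ} {x y : PreCell X (k + 1)} (h : Eqv x y) :
    Eqv (face b x) (face b y) :=
  (faceCompat X _ x y h).1 b

theorem Eqv.face_face (a b c : Bool) {k : ℕ} {x : PreCell X (k + 2)} (h : Eqv x x) :
    Eqv (PreCell.face a (PreCell.face b x)) (PreCell.face a (PreCell.face c x)) :=
  (faceCompat X _ x x h).2.1 a b c

theorem Eqv.faceTo (b : Bool) {i k : ℕ} (h : i ≤ k) {x y : PreCell X k} (hxy : Eqv x y) :
    Eqv (faceTo b h x) (faceTo b h y) :=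
  FaceCompat.faceTo (fun m _ => faceCompat X m) b h hxy

theorem Eqv.identTo {i k : ℕ} (h : i ≤ k) {x y : PreCell X i} (hxy : Eqv x y) :
    Eqv (identTo h x) (identTo h y) := by
  induction k, h using Nat.le_induction with
  | base => simpa using hxy
  | succ k h ih => rw [identTo_succ h, identTo_succ h]; exact ih.ident

end PreCell

/-! ### The free strict ω-category as a quotient -/

/-- The well-formed formal composites. -/
abbrev WFCell (X : OmegaGlob.{u}) (k : ℕ) : Type u := {x : PreCell X k // x.Eqv x}

instance wfCellSetoid (X : OmegaGlob.{u}) (k : ℕ) : Setoid (WFCell X k) where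
  r x y := x.1.Eqv y.1
  iseqv := ⟨fun x => x.2, fun h => h.symm, fun h h' => h.trans h'⟩

/-- The cells of the free strict `ω`-category. -/
def FreeCell (X : OmegaGlob.{u}) (k : ℕ) : Type u := Quotient (wfCellSetoid X k)

namespace FreeCell

open PreCell

variable {X Y : OmegaGlob.{u}}

/-- The class of a well-formed formal composite. -/
def mk {k : ℕ} (x : PreCell X k) (hx : x.Eqv x) : FreeCell X k :=
  Quotient.mk (wfCellSetoid X k) ⟨x, hx⟩

theorem mk_eq_mk {k : ℕ} {x y : PreCell X k} {hx : x.Eqv x} {hy : y.Eqv y} :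
    mk x hx = mk y hy ↔ x.Eqv y :=
  Quotient.eq (r := wfCellSetoid X k)

theorem exists_mk {k : ℕ} (x : FreeCell X k) : ∃ y hy, mk y hy = x := by
  obtain ⟨⟨y, hy⟩, rfl⟩ := Quotient.exists_rep x
  exact ⟨y, hy, rfl⟩

/-- A representative of a cell. -/
noncomputable def rep {k : ℕ} (x : FreeCell X k) : PreCell X k := x.exists_mk.choose

theorem rep_eqv {k : ℕ} (x : FreeCell X k) : x.rep.Eqv x.rep := x.exists_mk.choose_spec.choose

theorem mk_rep {k : ℕ} (x : FreeCell X k) : mk x.rep x.rep_eqv = x :=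
  x.exists_mk.choose_spec.choose_spec

theorem rep_mk {k : ℕ} {x : PreCell X k} (hx : x.Eqv x) : (mk x hx).rep.Eqv x :=
  mk_eq_mk.1 (mk_rep (mk x hx))

/-- The target of a cell if `b` is true, the source otherwise. -/
def face (b : Bool) {k : ℕ} : FreeCell X (k + 1) → FreeCell X k :=
  Quotient.lift (fun x => mk (PreCell.face b x.1) (x.2.face b)) fun _ _ h =>
    mk_eq_mk.2 (Eqv.face b h)

theorem face_mk (b : Bool) {k : ℕ} {x : PreCell X (k + 1)} (hx : x.Eqv x) :
    face b (mk x hx) = mk (PreCell.face b x) (hx.face b) :=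
  rfl

theorem face_face (a b c : Bool) {k : ℕ} (x : FreeCell X (k + 2)) :
    face a (face b x) = face a (face c x) := by
  obtain ⟨x, hx, rfl⟩ := x.exists_mk
  exact mk_eq_mk.2 (hx.face_face a b c)

/-- The identity of a cell. -/
def ident {k : ℕ} : FreeCell X k → FreeCell X (k + 1) :=
  Quotient.lift (fun x => mk (PreCell.ident x.1) x.2.ident) fun _ _ h =>
    mk_eq_mk.2 (Eqv.ident h)

theorem ident_mk {k : ℕ} {x : PreCell X k} (hx : x.Eqv x) :
    ident (mk x hx) = mk (PreCell.ident x) hx.ident :=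
  rfl

end FreeCell

/-- The globular set underlying the free strict `ω`-category. -/
def freeGlob (X : OmegaGlob.{u}) : OmegaGlob.{u} where
  cell := FreeCell X
  src := FreeCell.face false
  tgt := FreeCell.face true
  src_src := FreeCell.face_face _ _ _
  tgt_src := FreeCell.face_face _ _ _

namespace FreeCell

open PreCell

variable {X Y : OmegaGlob.{u}}

theorem descend_face_mk (b : Bool) {i k : ℕ} (h : i ≤ k) {x : PreCell X k} (hx : x.Eqv x) :
    descend (face b) h (mk x hx) = mk (faceTo b h x) (hx.faceTo b h) := by
  induction k, h using Nat.le_induction with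
  | base => simp
  | succ k h ih =>
    rw [descend_succ _ h, face_mk, ih (hx.face b)]
    exact mk_eq_mk.2 (by rw [faceTo_succ b h]; exact (hx.face b).faceTo b h)

theorem tgtTo_mk {i k : ℕ} (h : i ≤ k) {x : PreCell X k} (hx : x.Eqv x) :
    (freeGlob X).tgtTo h (mk x hx) = mk (faceTo true h x) (hx.faceTo true h) :=
  descend_face_mk true h hx

theorem srcTo_mk {i k : ℕ} (h : i ≤ k) {x : PreCell X k} (hx : x.Eqv x) :
    (freeGlob X).srcTo h (mk x hx) = mk (faceTo false h x) (hx.faceTo false h) :=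
  descend_face_mk false h hx

theorem identTo_mk {i k : ℕ} (h : i ≤ k) {x : PreCell X i} (hx : x.Eqv x) :
    (Nat.leRecOn h ident (mk x hx) : FreeCell X k) = mk (identTo h x) (hx.identTo h) := by
  induction k, h using Nat.le_induction with
  | base => simp [Nat.leRecOn_self]
  | succ k h ih =>
    rw [Nat.leRecOn_succ h, ih, ident_mk]
    exact mk_eq_mk.2 (by rw [identTo_succ h]; exact (hx.identTo h).ident)

theorem composable_mk {i k : ℕ} {h : i < k} {x y : PreCell X k} {hx : x.Eqv x} {hy : y.Eqv y} :
    (freeGlob X).Composable h (mk x hx) (mk y hy) ↔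
      Eqv (faceTo true h.le x) (faceTo false h.le y) := by
  change (freeGlob X).tgtTo _ _ = (freeGlob X).srcTo _ _ ↔ _
  rw [tgtTo_mk, srcTo_mk]
  exact mk_eq_mk

theorem comp_rep_eqv {i k : ℕ} (h : i < k) {x y : FreeCell X k}
    (hxy : (freeGlob X).Composable h x y) :
    Eqv (PreCell.comp h x.rep y.rep) (PreCell.comp h x.rep y.rep) := by
  rw [← mk_rep x, ← mk_rep y, composable_mk] at hxy
  exact .comp h x.rep_eqv y.rep_eqv hxy hxy

/-- The composite of two cells. -/
noncomputable def comp {i k : ℕ} (h : i < k) (x y : FreeCell X k)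
    (hxy : (freeGlob X).Composable h x y) : FreeCell X k :=
  mk (PreCell.comp h x.rep y.rep) (comp_rep_eqv h hxy)

theorem comp_eqv {i k : ℕ} {h : i < k} {x y : PreCell X k} {hx : x.Eqv x} {hy : y.Eqv y}
    (hxy : (freeGlob X).Composable h (mk x hx) (mk y hy)) :
    Eqv (PreCell.comp h x y) (PreCell.comp h x y) :=
  .comp h hx hy (composable_mk.1 hxy) (composable_mk.1 hxy)

/-- Composites are defined through chosen representatives because composability is a condition on
classes; independence of the choice is the `comp` rule of `Eqv`. -/
theorem comp_mk {i k : ℕ} (h : i < k) {x y : PreCell X k} {hx : x.Eqv x} {hy : y.Eqv y}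
    (hxy : (freeGlob X).Composable h (mk x hx) (mk y hy)) :
    comp h (mk x hx) (mk y hy) hxy = mk (PreCell.comp h x y) (comp_eqv hxy) := by
  have := (comp_rep_eqv h hxy).subWF.1.2.2
  exact mk_eq_mk.2 (.comp h (rep_mk hx) (rep_mk hy) this (composable_mk.1 hxy))

/-- The composability proof depends on the arguments, which obstructs rewriting them inside `comp`.
This form serves the unit laws, where one argument is a class only after computing an iterated
identity. -/
theorem comp_of_eq_mk {i k : ℕ} (h : i < k) {a b : FreeCell X k}
    (hab : (freeGlob X).Composable h a b) {x y : PreCell X k} {hx : x.Eqv x} {hy : y.Eqv y}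
    (ha : a = mk x hx) (hb : b = mk y hy) :
    ∃ hxy, comp h a b hab = mk (PreCell.comp h x y) hxy := by
  subst ha hb
  exact ⟨_, comp_mk h hab⟩

end FreeCell

/-- The free strict `ω`-category on a globular set. -/
noncomputable def free (X : OmegaGlob.{u}) : StrictOmegaCat.{u} where
  toOmegaGlob := freeGlob X
  ident := FreeCell.ident
  comp := FreeCell.comp
  src_ident x := by
    obtain ⟨x, hx, rfl⟩ := x.exists_mk
    exact FreeCell.mk_eq_mk.2 (by rwa [PreCell.face_ident])
  tgt_ident x := by
    obtain ⟨x, hx, rfl⟩ := x.exists_mk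
    exact FreeCell.mk_eq_mk.2 (by rwa [PreCell.face_ident])
  src_comp h x y hxy hxy' := by
    obtain ⟨x, hx, rfl⟩ := x.exists_mk
    obtain ⟨y, hy, rfl⟩ := y.exists_mk
    rw [FreeCell.comp_mk]
    refine (FreeCell.mk_eq_mk.2 ?_).trans
      (FreeCell.comp_mk h (hx := hx.face false) (hy := hy.face false) hxy').symm
    rw [← PreCell.face_comp_of_lt _ h (Nat.lt_succ_of_lt h)]
    exact (FreeCell.comp_eqv hxy).face false
  tgt_comp h x y hxy hxy' := by
    obtain ⟨x, hx, rfl⟩ := x.exists_mk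
    obtain ⟨y, hy, rfl⟩ := y.exists_mk
    rw [FreeCell.comp_mk]
    refine (FreeCell.mk_eq_mk.2 ?_).trans
      (FreeCell.comp_mk h (hx := hx.face true) (hy := hy.face true) hxy').symm
    rw [← PreCell.face_comp_of_lt _ h (Nat.lt_succ_of_lt h)]
    exact (FreeCell.comp_eqv hxy).face true
  src_comp_self x y hxy := by
    obtain ⟨x, hx, rfl⟩ := x.exists_mk
    obtain ⟨y, hy, rfl⟩ := y.exists_mk
    rw [FreeCell.comp_mk]
    exact FreeCell.mk_eq_mk.2 (by rw [PreCell.face_comp_self]; exact hx.face false)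
  tgt_comp_self x y hxy := by
    obtain ⟨x, hx, rfl⟩ := x.exists_mk
    obtain ⟨y, hy, rfl⟩ := y.exists_mk
    rw [FreeCell.comp_mk]
    exact FreeCell.mk_eq_mk.2 (by rw [PreCell.face_comp_self]; exact hy.face true)
  id_comp h x hx' := by
    obtain ⟨x, hx, rfl⟩ := x.exists_mk
    obtain ⟨hxy, e⟩ := FreeCell.comp_of_eq_mk h hx'
      ((congrArg _ (FreeCell.srcTo_mk h.le hx)).trans (FreeCell.identTo_mk h.le _)) rfl
    exact e.trans (FreeCell.mk_eq_mk.2 (.ax (.id_comp h _ _) hxy hx))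
  comp_id h x hx' := by
    obtain ⟨x, hx, rfl⟩ := x.exists_mk
    obtain ⟨hxy, e⟩ := FreeCell.comp_of_eq_mk h hx' rfl
      ((congrArg _ (FreeCell.tgtTo_mk h.le hx)).trans (FreeCell.identTo_mk h.le _))
    exact e.trans (FreeCell.mk_eq_mk.2 (.ax (.comp_id h _ _) hxy hx))
  assoc h x y z hxy hyz hl hr := by
    obtain ⟨x, hx, rfl⟩ := x.exists_mk
    obtain ⟨y, hy, rfl⟩ := y.exists_mk
    obtain ⟨z, hz, rfl⟩ := z.exists_mk
    simp only [FreeCell.comp_mk] at hl hr ⊢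
    exact FreeCell.mk_eq_mk.2 (.ax (.assoc h _ _ _) (FreeCell.comp_eqv hl) (FreeCell.comp_eqv hr))
  ident_comp h x y hxy hxy' := by
    obtain ⟨x, hx, rfl⟩ := x.exists_mk
    obtain ⟨y, hy, rfl⟩ := y.exists_mk
    simp only [FreeCell.comp_mk, FreeCell.ident_mk] at hxy' ⊢
    exact FreeCell.mk_eq_mk.2 (.ax (.ident_comp h _ _) (FreeCell.comp_eqv hxy).ident
      (FreeCell.comp_eqv hxy'))
  exchange hij hjk x x' y y' hxy hxx' hyy' hxy' hl hr := by
    obtain ⟨x, hx, rfl⟩ := x.exists_mk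
    obtain ⟨y, hy, rfl⟩ := y.exists_mk
    obtain ⟨x', hx', rfl⟩ := x'.exists_mk
    obtain ⟨y', hy', rfl⟩ := y'.exists_mk
    simp only [FreeCell.comp_mk] at hl hr ⊢
    exact FreeCell.mk_eq_mk.2 (.ax (.exchange hij hjk _ _ _ _) (FreeCell.comp_eqv hl)
      (FreeCell.comp_eqv hr))

end OmegaGlob

/-! ### Faces in strict ω-categories and evaluation of formal composites -/

namespace OmegaGlob

theorem descend_face_face (X : OmegaGlob.{u}) (b c : Bool) {i k : ℕ} (h : i < k)
    (h' : i ≤ k + 1) (x : X.cell (k + 1)) :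
    descend (X.face b) h.le (X.face c x) = descend (X.face b) h' x := by
  obtain ⟨k, rfl⟩ := Nat.exists_eq_add_one_of_ne_zero (Nat.ne_zero_of_lt h)
  rw [descend_succ _ h.le h', descend_succ _ (Nat.lt_succ_iff.1 h),
    descend_succ _ (Nat.lt_succ_iff.1 h), X.face_face b c b]

theorem Composable.face {X : OmegaGlob.{u}} (b : Bool) {i k : ℕ} (h : i < k) {h' : i < k + 1}
    {x y : X.cell (k + 1)} (hxy : X.Composable h' x y) :
    X.Composable h (X.face b x) (X.face b y) :=
  ((X.descend_face_face true b h h'.le x).trans hxy).trans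
    (X.descend_face_face false b h h'.le y).symm

end OmegaGlob

namespace StrictOmegaCat

variable (C : StrictOmegaCat.{u})

theorem face_ident (b : Bool) {k : ℕ} (x : C.cell k) : C.face b (C.ident x) = x := by
  cases b
  · exact C.src_ident x
  · exact C.tgt_ident x

theorem face_comp_of_lt (b : Bool) {i k : ℕ} (h : i < k) (x y : C.cell (k + 1))
    (hxy : C.Composable (Nat.lt_succ_of_lt h) x y) :
    C.face b (C.comp (Nat.lt_succ_of_lt h) x y hxy) =
      C.comp h (C.face b x) (C.face b y) (hxy.face b h) := by
  cases b
  · exact C.src_comp h x y hxy (hxy.face false h)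
  · exact C.tgt_comp h x y hxy (hxy.face true h)

theorem face_comp_self (b : Bool) {k : ℕ} (x y : C.cell (k + 1))
    (hxy : C.Composable k.lt_succ_self x y) :
    C.face b (C.comp k.lt_succ_self x y hxy) = if b then C.face b y else C.face b x := by
  cases b
  · exact C.src_comp_self x y hxy
  · exact C.tgt_comp_self x y hxy

theorem descend_face_identTo (b : Bool) {i k : ℕ} (h : i ≤ k) (x : C.cell i) :
    descend (C.face b) h (Nat.leRecOn h C.ident x) = x := by
  induction k, h using Nat.le_induction with
  | base => simp [Nat.leRecOn_self]
  | succ k h ih => rw [descend_succ _ h, Nat.leRecOn_succ h, face_ident, ih]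

end StrictOmegaCat

namespace OmegaGlob
namespace PreCell

variable {X Y Z : OmegaGlob.{u}} {C : StrictOmegaCat.{u}}

/-- A formal composite has a given value in a strict `ω`-category. -/
inductive Eval (f : Hom X C.toOmegaGlob) : ∀ {k : ℕ}, PreCell X k → C.cell k → Prop
  | gen {k : ℕ} (x : X.cell k) : Eval f (gen x) (f.map k x)
  | ident {k : ℕ} {x : PreCell X k} {a : C.cell k} (h : Eval f x a) :
    Eval f (ident x) (C.ident a)
  | comp {i k : ℕ} (h : i < k) {x y : PreCell X k} {a b : C.cell k} (hx : Eval f x a)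
    (hy : Eval f y b) (hab : C.Composable h a b) : Eval f (comp h x y) (C.comp h a b hab)

variable {f : Hom X C.toOmegaGlob}

/-- Evaluation is a relation because composing in `C` needs a composability proof, which a raw
composite cannot supply; uniqueness makes it a partial function. -/
theorem Eval.unique {k : ℕ} {x : PreCell X k} {a b : C.cell k} (ha : Eval f x a)
    (hb : Eval f x b) : a = b := by
  induction ha with
  | gen x => cases hb; rfl
  | ident _ ih =>
    cases hb with
    | ident h => rw [ih h]
  | comp h _ _ _ ihx ihy =>
    cases hb with
    | comp _ hx hy _ =>
      obtain rfl := ihx hx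
      obtain rfl := ihy hy
      rfl

theorem Eval.face (b : Bool) {k : ℕ} {x : PreCell X (k + 1)} {a : C.cell (k + 1)}
    (h : Eval f x a) : Eval f (face b x) (C.face b a) := by
  -- The index `k + 1` is freed so that induction on the evaluation applies.
  suffices ∀ m (x : PreCell X m) (a : C.cell m), Eval f x a → ∀ k (e : m = k + 1),
      Eval f (PreCell.face b (e ▸ x)) (C.face b (e ▸ a)) from this _ x a h k rfl
  intro m x a h
  induction h with
  | gen x =>
    rintro k rfl
    simp only [face_gen, ← f.map_face]
    exact .gen _
  | ident h _ =>
    intro k e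
    cases e
    simp only [face_ident, C.face_ident]
    exact h
  | @comp i m h x y a c hx hy hac ihx ihy =>
    rintro k rfl
    specialize ihx k rfl
    specialize ihy k rfl
    simp only at *
    rcases Nat.lt_succ_iff_lt_or_eq.1 h with h' | rfl
    · rw [face_comp_of_lt b h', C.face_comp_of_lt b h']
      exact .comp h' ihx ihy _
    · rw [face_comp_self, C.face_comp_self]
      cases b
      · exact ihx
      · exact ihy

theorem Eval.faceTo (b : Bool) {i k : ℕ} (h : i ≤ k) {x : PreCell X k} {a : C.cell k}
    (hx : Eval f x a) : Eval f (faceTo b h x) (descend (C.face b) h a) :=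
  descend_rel (PreCell.face b) (C.face b) (fun x a => Eval f x a) h (fun _ h => h.face b) hx

theorem Eval.of_identTo {i k : ℕ} (h : i ≤ k) {x : PreCell X i} {c : C.cell k}
    (hc : Eval f (identTo h x) c) : ∃ a, Eval f x a ∧ c = Nat.leRecOn h C.ident a := by
  induction k, h using Nat.le_induction with
  | base => exact ⟨c, by simpa using hc, (Nat.leRecOn_self c).symm⟩
  | succ k h ih =>
    rw [identTo_succ h] at hc
    cases hc with
    | ident hc =>
      obtain ⟨a, ha, rfl⟩ := ih hc
      exact ⟨a, ha, (Nat.leRecOn_succ h a).symm⟩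

theorem Ax.eval_eq {k : ℕ} {x y : PreCell X k} (h : Ax x y) {a b : C.cell k} (hx : Eval f x a)
    (hy : Eval f y b) : a = b := by
  cases h with
  | id_comp h c x =>
    cases hx with
    | comp _ hc hx hcx =>
      obtain ⟨c, -, rfl⟩ := hc.of_identTo h.le
      obtain rfl := hx.unique hy
      -- Composability in `C` forces `c` to be the source of the other factor, which gives the unit
      -- law its required shape.
      obtain rfl := (C.descend_face_identTo true h.le c).symm.trans hcx
      exact C.id_comp h _ hcx
  | comp_id h c x =>
    cases hx with
    | comp _ hx hc hcx =>
      obtain ⟨c, -, rfl⟩ := hc.of_identTo h.le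
      obtain rfl := hx.unique hy
      obtain rfl := hcx.trans (C.descend_face_identTo false h.le c)
      exact C.comp_id h _ hcx
  | assoc h x y z =>
    cases hx with
    | comp _ hxy hz hl =>
      cases hxy with
      | comp _ hx hy' hxy =>
        cases hy with
        | comp _ hx₁ hyz hr =>
          cases hyz with
          | comp _ hy₁ hz₁ hyz =>
            obtain rfl := hx.unique hx₁
            obtain rfl := hy'.unique hy₁
            obtain rfl := hz.unique hz₁
            exact C.assoc h _ _ _ hxy hyz hl hr
  | ident_comp h x y =>
    cases hx with
    | ident hxy =>
      cases hxy with
      | comp _ hx hy' hxy =>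
        cases hy with
        | comp _ hx₁ hy₁ hr =>
          cases hx₁ with
          | ident hx₁ =>
            cases hy₁ with
            | ident hy₁ =>
              obtain rfl := hx.unique hx₁
              obtain rfl := hy'.unique hy₁
              exact C.ident_comp h _ _ hxy hr
  | exchange hij hjk x x' y y' =>
    cases hx with
    | comp _ hxy hxy' hl =>
      cases hxy with
      | comp _ hx₁ hy₁ hxy =>
        cases hxy' with
        | comp _ hx₁' hy₁' hxy' =>
          cases hy with
          | comp _ hxx' hyy' hr =>
            cases hxx' with
            | comp _ hx₂ hx₂' hxx' =>
              cases hyy' with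
              | comp _ hy₂ hy₂' hyy' =>
                obtain rfl := hx₁.unique hx₂
                obtain rfl := hx₁'.unique hx₂'
                obtain rfl := hy₁.unique hy₂
                obtain rfl := hy₁'.unique hy₂'
                exact C.exchange hij hjk _ _ _ _ hxy hxx' hyy' hxy' hl hr

/-- In the `comp` case, the premise on faces yields a common value of the formal target and source;
by uniqueness it is both the `i`-target of `a` and the `i`-source of `b`, so these compose in `C`.
-/
theorem Eqv.exists_eval (f : Hom X C.toOmegaGlob) {k : ℕ} {x y : PreCell X k} (h : Eqv x y) :
    ∃ a, Eval f x a ∧ Eval f y a := by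
  induction h with
  | gen x => exact ⟨_, .gen x, .gen x⟩
  | symm _ ih =>
    obtain ⟨a, hx, hy⟩ := ih
    exact ⟨a, hy, hx⟩
  | trans _ _ ih ih' =>
    obtain ⟨a, hx, hy⟩ := ih
    obtain ⟨b, hy', hz⟩ := ih'
    obtain rfl := hy.unique hy'
    exact ⟨a, hx, hz⟩
  | ident _ ih =>
    obtain ⟨a, hx, hy⟩ := ih
    exact ⟨_, hx.ident, hy.ident⟩
  | comp h _ _ _ _ ihx ihy ihxy _ =>
    obtain ⟨a, hx, hx'⟩ := ihx
    obtain ⟨b, hy, hy'⟩ := ihy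
    obtain ⟨c, ha, hb⟩ := ihxy
    have hab : C.Composable h a b :=
      ((hx.faceTo true h.le).unique ha).trans (hb.unique (hy.faceTo false h.le))
    exact ⟨_, hx.comp h hy hab, hx'.comp h hy' hab⟩
  | ax h _ _ ihx ihy =>
    obtain ⟨a, hx, -⟩ := ihx
    obtain ⟨b, hy, -⟩ := ihy
    obtain rfl := h.eval_eq hx hy
    exact ⟨a, hx, hy⟩

/-! ### Relabelling generators along a morphism -/

/-- The action of a morphism of globular sets on formal composites. -/
def map (f : Hom X Y) : ∀ {k : ℕ}, PreCell X k → PreCell Y k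
  | _, gen x => gen (f.map _ x)
  | _, ident x => ident (map f x)
  | _, comp h x y => comp h (map f x) (map f y)

theorem map_comp (f : X ⟶ Y) (g : Y ⟶ Z) {k : ℕ} (x : PreCell X k) :
    map (f ≫ g) x = map g (map f x) := by
  induction x with
  | gen x => rfl
  | ident x ih => simp only [map, ih]
  | comp h x y ihx ihy => simp only [map, ihx, ihy]

theorem map_face (f : Hom X Y) (b : Bool) {k : ℕ} (x : PreCell X (k + 1)) :
    map f (face b x) = face b (map f x) := by
  suffices ∀ m (x : PreCell X m) k (e : m = k + 1),
      map f (PreCell.face b (e ▸ x)) = face b (map f (e ▸ x)) from this _ x k rfl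
  intro m x
  induction x with
  | gen x =>
    rintro k rfl
    simp only [face_gen, map, f.map_face]
  | ident x _ =>
    intro k e
    cases e
    simp only [map, face_ident]
  | @comp i m h x y ihx ihy =>
    rintro k rfl
    specialize ihx k rfl
    specialize ihy k rfl
    simp only at *
    rcases Nat.lt_succ_iff_lt_or_eq.1 h with h' | rfl
    · simp only [map, face_comp_of_lt b h', ihx, ihy]
    · simp only [map, face_comp_self]
      cases b
      · exact ihx
      · exact ihy

theorem map_faceTo (f : Hom X Y) (b : Bool) {i k : ℕ} (h : i ≤ k) (x : PreCell X k) :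
    map f (faceTo b h x) = faceTo b h (map f x) :=
  descend_rel (face b) (face b) (fun x y => map f x = y) h
    (fun _ h => by rw [map_face, h]) rfl

theorem map_identTo (f : Hom X Y) {i k : ℕ} (h : i ≤ k) (x : PreCell X i) :
    map f (identTo h x) = identTo h (map f x) := by
  induction k, h using Nat.le_induction with
  | base => simp
  | succ k h ih => rw [identTo_succ h, identTo_succ h, map, ih]

theorem Ax.map (f : Hom X Y) {k : ℕ} {x y : PreCell X k} (h : Ax x y) :
    Ax (map f x) (map f y) := by
  cases h with
  | id_comp h a x => simp only [PreCell.map, map_identTo]; exact .id_comp h _ _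
  | comp_id h a x => simp only [PreCell.map, map_identTo]; exact .comp_id h _ _
  | assoc h x y z => exact .assoc h _ _ _
  | ident_comp h x y => exact .ident_comp h _ _
  | exchange hij hjk x x' y y' => exact .exchange hij hjk _ _ _ _

theorem Eqv.map (f : Hom X Y) {k : ℕ} {x y : PreCell X k} (h : Eqv x y) :
    Eqv (map f x) (map f y) := by
  induction h with
  | gen x => exact .gen _
  | symm _ ih => exact ih.symm
  | trans _ _ ih ih' => exact ih.trans ih'
  | ident _ ih => exact ih.ident
  | comp h _ _ _ _ ihx ihy ihxy ihxy' =>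
    rw [map_faceTo, map_faceTo] at ihxy ihxy'
    exact .comp h ihx ihy ihxy ihxy'
  | ax h _ _ ihx ihy => exact .ax (h.map f) ihx ihy

end PreCell

/-! ### The universal property and the free functor -/

namespace FreeCell

open PreCell

variable {X Y : OmegaGlob.{u}} {C : StrictOmegaCat.{u}}

theorem exists_eval (f : Hom X C.toOmegaGlob) {k : ℕ} (x : FreeCell X k) :
    ∃ a, Eval f x.rep a :=
  let ⟨a, ha, _⟩ := x.rep_eqv.exists_eval f
  ⟨a, ha⟩

/-- The value of a cell of the free strict `ω`-category. -/
noncomputable def eval (f : Hom X C.toOmegaGlob) {k : ℕ} (x : FreeCell X k) : C.cell k :=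
  (x.exists_eval f).choose

theorem eval_mk_eq {f : Hom X C.toOmegaGlob} {k : ℕ} {x : PreCell X k} (hx : x.Eqv x)
    {a : C.cell k} (ha : Eval f x a) : eval f (mk x hx) = a := by
  have h : Eval f (mk x hx).rep (eval f (mk x hx)) := ((mk x hx).exists_eval f).choose_spec
  obtain ⟨b, hb, hb'⟩ := (rep_mk hx).exists_eval f
  rw [h.unique hb, ha.unique hb']

end FreeCell

open FreeCell PreCell

variable {X Y : OmegaGlob.{u}} {C : StrictOmegaCat.{u}}

/-- The canonical morphism from a globular set to the free strict `ω`-category on it. -/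
def freeUnit (X : OmegaGlob.{u}) : X ⟶ StrictOmegaCat.forget.obj (free X) where
  map k x := FreeCell.mk (.gen x) (.gen x)
  map_src x := FreeCell.mk_eq_mk.2 (by rw [PreCell.face_gen]; exact .gen _)
  map_tgt x := FreeCell.mk_eq_mk.2 (by rw [PreCell.face_gen]; exact .gen _)

/-- The extension of a morphism to the free strict `ω`-category. -/
noncomputable def freeLift (f : X ⟶ StrictOmegaCat.forget.obj C) : free X ⟶ C where
  map k := FreeCell.eval f
  map_src x := by
    obtain ⟨x, hx, rfl⟩ := x.exists_mk
    obtain ⟨a, ha, -⟩ := hx.exists_eval f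
    rw [eval_mk_eq hx ha]
    exact eval_mk_eq (hx.face false) (ha.face false)
  map_tgt x := by
    obtain ⟨x, hx, rfl⟩ := x.exists_mk
    obtain ⟨a, ha, -⟩ := hx.exists_eval f
    rw [eval_mk_eq hx ha]
    exact eval_mk_eq (hx.face true) (ha.face true)
  map_ident x := by
    obtain ⟨x, hx, rfl⟩ := x.exists_mk
    obtain ⟨a, ha, -⟩ := hx.exists_eval f
    rw [eval_mk_eq hx ha]
    exact eval_mk_eq hx.ident ha.ident
  map_comp h x y hxy hxy' := by
    obtain ⟨x, hx, rfl⟩ := x.exists_mk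
    obtain ⟨y, hy, rfl⟩ := y.exists_mk
    obtain ⟨a, ha, -⟩ := hx.exists_eval f
    obtain ⟨b, hb, -⟩ := hy.exists_eval f
    simp only [eval_mk_eq hx ha, eval_mk_eq hy hb] at hxy' ⊢
    exact (congrArg _ (FreeCell.comp_mk h hxy)).trans
      (eval_mk_eq (comp_eqv hxy) (ha.comp h hb hxy'))

/-- Well-formed composites have well-formed subterms, so agreement on generators spreads by
induction on the raw composite. -/
theorem free_hom_ext {g h : free X ⟶ C}
    (e : freeUnit X ≫ StrictOmegaCat.forget.map g = freeUnit X ≫ StrictOmegaCat.forget.map h) :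
    g = h := by
  suffices ∀ k (x : PreCell X k) (hx : x.Eqv x),
      g.map k (FreeCell.mk x hx) = h.map k (FreeCell.mk x hx) by
    apply StrictOmegaCat.Hom.ext
    ext k x
    obtain ⟨x, hx, rfl⟩ := FreeCell.exists_mk x
    exact this k x hx
  intro k x
  induction x with
  | @gen k x =>
    intro hx
    exact congrFun (congrFun (congrArg Hom.map e) k) x
  | ident x ih =>
    intro hx
    have hx' : x.Eqv x := hx.subWF.1
    have := (g.map_ident (FreeCell.mk x hx')).trans
      ((congrArg _ (ih hx')).trans (h.map_ident (FreeCell.mk x hx')).symm)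
    exact this
  | comp hik x y ihx ihy =>
    intro hxy
    obtain ⟨hx, hy, hc⟩ := hxy.subWF.1
    have hc' : (freeGlob X).Composable hik (FreeCell.mk x hx) (FreeCell.mk y hy) :=
      composable_mk.2 hc
    have eg := g.map_comp hik _ _ hc' (g.toHom.map_composable hik hc')
    have eh := h.map_comp hik _ _ hc' (h.toHom.map_composable hik hc')
    have e' := FreeCell.comp_mk hik hc'
    refine (congrArg _ e'.symm).trans ((eg.trans ?_).trans (eh.symm.trans (congrArg _ e')))
    simp only [ihx hx, ihy hy]

theorem freeUnit_freeLift (f : X ⟶ StrictOmegaCat.forget.obj C) :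
    freeUnit X ≫ StrictOmegaCat.forget.map (freeLift f) = f := by
  apply Hom.ext
  funext k x
  exact eval_mk_eq (.gen x) (.gen x)

/-- The universal property of the free strict `ω`-category. -/
noncomputable def freeEquiv (X : OmegaGlob.{u}) (C : StrictOmegaCat.{u}) :
    (free X ⟶ C) ≃ (X ⟶ StrictOmegaCat.forget.obj C) where
  toFun g := freeUnit X ≫ StrictOmegaCat.forget.map g
  invFun := freeLift
  left_inv _ := free_hom_ext (freeUnit_freeLift _)
  right_inv := freeUnit_freeLift

/-- The free strict `ω`-category functor. -/
noncomputable def freeFunctor : OmegaGlob.{u} ⥤ StrictOmegaCat.{u} :=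
  Adjunction.leftAdjointOfEquiv (G := StrictOmegaCat.forget) freeEquiv fun _ _ _ _ _ => rfl

/-- The free strict `ω`-category functor is left adjoint to the forgetful functor. -/
noncomputable def freeAdj : freeFunctor.{u} ⊣ StrictOmegaCat.forget :=
  Adjunction.adjunctionOfEquivLeft freeEquiv fun _ _ _ _ _ => rfl

/-- This identifies the abstractly defined action of the free functor with relabelling, turning the
colimit questions into syntactic ones. -/
theorem PreCell.Eqv.eval_map (f : X ⟶ Y) {k : ℕ} {x : PreCell X k} (hx : x.Eqv x) :
    Eval (f ≫ freeUnit Y) x (FreeCell.mk (x.map f) (hx.map f)) := by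
  induction x with
  | gen x => exact .gen x
  | ident x ih =>
    have hx' : x.Eqv x := hx.subWF.1
    exact (ih hx').ident
  | comp h x y ihx ihy =>
    obtain ⟨hx, hy, hc⟩ := hx.subWF.1
    have hc' : (freeGlob Y).Composable h (FreeCell.mk _ (hx.map f)) (FreeCell.mk _ (hy.map f)) :=
      composable_mk.2 (by rw [← map_faceTo, ← map_faceTo]; exact hc.map f)
    have := (ihx hx).comp h (ihy hy) hc'
    exact (FreeCell.comp_mk h hc') ▸ this

theorem freeFunctor_map_mk (f : X ⟶ Y) {k : ℕ} {x : PreCell X k} (hx : x.Eqv x) :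
    (freeFunctor.map f).map k (FreeCell.mk x hx) = FreeCell.mk (x.map f) (hx.map f) :=
  eval_mk_eq hx (hx.eval_map f)

end OmegaGlob

/-! ### Filtered diagrams in bounded degree, and their lifting to composites -/

namespace OmegaGlob

variable {J : Type u} [Category.{u} J]

/-- In degrees at most `n`, a cocone on `D` satisfies the elementwise characterization of filtered
colimits of sets. -/
structure FilteredUpTo (D : J ⥤ OmegaGlob.{u}) {Y : OmegaGlob.{u}} (p : ∀ j, D.obj j ⟶ Y)
    (n : ℕ) : Prop where
  w : ∀ {i j : J} (f : i ⟶ j), D.map f ≫ p j = p i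
  surj : ∀ {k : ℕ}, k ≤ n → ∀ y : Y.cell k, ∃ j x, (p j).map k x = y
  inj : ∀ {k : ℕ}, k ≤ n → ∀ {j : J} (x y : (D.obj j).cell k), (p j).map k x = (p j).map k y →
    ∃ (i : J) (f : j ⟶ i), (D.map f).map k x = (D.map f).map k y

namespace FilteredUpTo

open PreCell

variable {D : J ⥤ OmegaGlob.{u}} {Y : OmegaGlob.{u}} {p : ∀ j, D.obj j ⟶ Y} {n : ℕ}

theorem map_w (H : FilteredUpTo D p n) {i j : J} (f : i ⟶ j) {k : ℕ}
    (x : PreCell (D.obj i) k) : ((x.map (D.map f)).map (p j)) = x.map (p i) := by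
  rw [← PreCell.map_comp, H.w]

variable [IsFiltered J]

theorem exists_lift₂ (H : FilteredUpTo D p n) {k l : ℕ} {x : PreCell Y k} {y : PreCell Y l}
    (hx : ∃ j x', PreCell.map (p j) x' = x) (hy : ∃ j y', PreCell.map (p j) y' = y) :
    ∃ j x' y', PreCell.map (p j) x' = x ∧ PreCell.map (p j) y' = y := by
  obtain ⟨i, x', rfl⟩ := hx
  obtain ⟨j, y', rfl⟩ := hy
  exact ⟨_, _, _, H.map_w (IsFiltered.leftToMax i j) x', H.map_w (IsFiltered.rightToMax i j) y'⟩

/-- A composite has finitely many generators, all of degree at most `k ≤ n`; each lifts to some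
stage, and filteredness provides a common one. -/
theorem exists_lift (H : FilteredUpTo D p n) {k : ℕ} (hk : k ≤ n) (x : PreCell Y k) :
    ∃ j x', PreCell.map (p j) x' = x := by
  induction x with
  | gen x =>
    obtain ⟨j, x, rfl⟩ := H.surj hk x
    exact ⟨j, .gen x, rfl⟩
  | ident x ih =>
    obtain ⟨j, x, rfl⟩ := ih (Nat.le_of_succ_le hk)
    exact ⟨j, x.ident, rfl⟩
  | comp h x y ihx ihy =>
    obtain ⟨j, x, y, rfl, rfl⟩ := H.exists_lift₂ (ihx hk) (ihy hk)
    exact ⟨j, x.comp h y, rfl⟩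

/-- Relabelling preserves the shape of the tree, so only finitely many pairs of generators have to
be merged. -/
theorem exists_map_eq (H : FilteredUpTo D p n) {k : ℕ} (hk : k ≤ n) {j : J}
    (x y : PreCell (D.obj j) k) (h : x.map (p j) = y.map (p j)) :
    ∃ (i : J) (f : j ⟶ i), x.map (D.map f) = y.map (D.map f) := by
  induction x with
  | gen x =>
    cases y with
    | gen y =>
      simp only [PreCell.map, PreCell.gen.injEq] at h
      obtain ⟨i, f, e⟩ := H.inj hk x y h
      exact ⟨i, f, by simp only [PreCell.map, e]⟩
    | ident y => simp [PreCell.map] at h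
    | comp _ y y' => simp [PreCell.map] at h
  | ident x ih =>
    cases y with
    | gen y => simp [PreCell.map] at h
    | ident y =>
      simp only [PreCell.map, PreCell.ident.injEq] at h
      obtain ⟨i, f, e⟩ := ih (Nat.le_of_succ_le hk) y h
      exact ⟨i, f, by simp only [PreCell.map, e]⟩
    | comp _ y y' => simp [PreCell.map] at h
  | comp _ x x' ih ih' =>
    cases y with
    | gen y => simp [PreCell.map] at h
    | ident y => simp [PreCell.map] at h
    | comp _ y y' =>
      simp only [PreCell.map, PreCell.comp.injEq] at h
      obtain ⟨rfl, h, h'⟩ := h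
      obtain ⟨i, f, e⟩ := ih hk y h
      obtain ⟨i', f', e'⟩ := ih' hk y' h'
      obtain ⟨m, g, g', hg⟩ := IsFiltered.span f f'
      refine ⟨m, f ≫ g, ?_⟩
      have e₁ : x.map (D.map (f ≫ g)) = y.map (D.map (f ≫ g)) := by
        rw [D.map_comp, PreCell.map_comp, PreCell.map_comp, e]
      have e₂ : x'.map (D.map (f ≫ g)) = y'.map (D.map (f ≫ g)) := by
        rw [hg, D.map_comp, PreCell.map_comp, PreCell.map_comp, e']
      simp only [PreCell.map, e₁, e₂]

/-- The relation comes from a stage of the filtered diagram. -/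
def LiftEqv (p : ∀ j, D.obj j ⟶ Y) {k : ℕ} (x y : PreCell Y k) : Prop :=
  ∃ j x' y', PreCell.map (p j) x' = x ∧ PreCell.map (p j) y' = y ∧ Eqv x' y'

/-- The prescribed lifts and those carrying the derivation have the same images in `Y`, hence
coincide at a later stage, to which the derivation is pushed. -/
theorem LiftEqv.exists_eqv (H : FilteredUpTo D p n) {k : ℕ} (hk : k ≤ n) {x y : PreCell Y k}
    (h : LiftEqv p x y) {j : J} (x' y' : PreCell (D.obj j) k) (hx : x'.map (p j) = x)
    (hy : y'.map (p j) = y) :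
    ∃ (i : J) (f : j ⟶ i), Eqv (x'.map (D.map f)) (y'.map (D.map f)) := by
  obtain ⟨j₀, x₀, y₀, rfl, rfl, h₀⟩ := h
  have key : ∀ {i : J} (f : j ⟶ i) (f₀ : j₀ ⟶ i) (z' : PreCell (D.obj j) k)
      (z₀ : PreCell (D.obj j₀) k), z'.map (p j) = z₀.map (p j₀) →
      ∃ (m : J) (g : i ⟶ m), z'.map (D.map (f ≫ g)) = z₀.map (D.map (f₀ ≫ g)) := by
    intro i f f₀ z' z₀ hz
    rw [← H.map_w f, ← H.map_w f₀] at hz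
    obtain ⟨m, g, e⟩ := H.exists_map_eq hk _ _ hz
    exact ⟨m, g, by simpa only [D.map_comp, PreCell.map_comp] using e⟩
  obtain ⟨i, g, e⟩ := key (IsFiltered.leftToMax j j₀) (IsFiltered.rightToMax j j₀) x' x₀ hx
  obtain ⟨m, g', e'⟩ := key (IsFiltered.leftToMax j j₀ ≫ g) (IsFiltered.rightToMax j j₀ ≫ g)
    y' y₀ hy
  refine ⟨m, (IsFiltered.leftToMax j j₀ ≫ g) ≫ g', ?_⟩
  rw [e', D.map_comp, PreCell.map_comp, e, ← PreCell.map_comp, ← D.map_comp]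
  exact h₀.map _

theorem exists_lift_ax (H : FilteredUpTo D p n) {k : ℕ} (hk : k ≤ n) {x y : PreCell Y k}
    (h : Ax x y) :
    ∃ j x' y', PreCell.map (p j) x' = x ∧ PreCell.map (p j) y' = y ∧ Ax x' y' := by
  cases h with
  | id_comp h a =>
    obtain ⟨j, a, x, rfl, rfl⟩ :=
      H.exists_lift₂ (H.exists_lift (h.le.trans hk) a) (H.exists_lift hk y)
    exact ⟨j, _, _, by simp only [PreCell.map, map_identTo], rfl, .id_comp h a x⟩
  | comp_id h a =>
    obtain ⟨j, a, x, rfl, rfl⟩ :=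
      H.exists_lift₂ (H.exists_lift (h.le.trans hk) a) (H.exists_lift hk y)
    exact ⟨j, _, _, by simp only [PreCell.map, map_identTo], rfl, .comp_id h a x⟩
  | assoc h x y z =>
    obtain ⟨j, z, rfl⟩ := H.exists_lift hk z
    obtain ⟨j₁, x, y, rfl, rfl⟩ := H.exists_lift₂ (H.exists_lift hk x) (H.exists_lift hk y)
    refine ⟨_, _, _, ?_, ?_, .assoc h (x.map (D.map (IsFiltered.leftToMax j₁ j)))
      (y.map (D.map (IsFiltered.leftToMax j₁ j))) (z.map (D.map (IsFiltered.rightToMax j₁ j)))⟩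
    all_goals simp only [PreCell.map, H.map_w]
  | @ident_comp i k h x y =>
    have hk' := Nat.le_of_succ_le hk
    obtain ⟨j, x, y, rfl, rfl⟩ := H.exists_lift₂ (H.exists_lift hk' x) (H.exists_lift hk' y)
    exact ⟨j, _, _, rfl, rfl, .ident_comp h x y⟩
  | exchange hij hjk x x' y y' =>
    obtain ⟨j, x, y, rfl, rfl⟩ := H.exists_lift₂ (H.exists_lift hk x) (H.exists_lift hk y)
    obtain ⟨j', x', y', rfl, rfl⟩ := H.exists_lift₂ (H.exists_lift hk x') (H.exists_lift hk y')
    refine ⟨_, _, _, ?_, ?_, .exchange hij hjk (x.map (D.map (IsFiltered.leftToMax j j')))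
      (x'.map (D.map (IsFiltered.rightToMax j j'))) (y.map (D.map (IsFiltered.leftToMax j j')))
      (y'.map (D.map (IsFiltered.rightToMax j j')))⟩
    all_goals simp only [PreCell.map, H.map_w]

/-- A derivation is finite, so it can be replayed at one stage: transitivity needs the two lifts of
the middle term merged, `comp` needs both composability conditions realised, and `ax` needs both
sides of the lifted axiom to become well-formed. -/
theorem liftEqv (H : FilteredUpTo D p n) {k : ℕ} (hk : k ≤ n) {x y : PreCell Y k}
    (h : Eqv x y) : LiftEqv p x y := by
  induction h with
  | gen x =>
    obtain ⟨j, x, rfl⟩ := H.surj hk x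
    exact ⟨j, .gen x, .gen x, rfl, rfl, .gen x⟩
  | symm _ ih =>
    obtain ⟨j, x, y, hx, hy, h⟩ := ih hk
    exact ⟨j, y, x, hy, hx, h.symm⟩
  | trans _ _ ih ih' =>
    obtain ⟨j, x, y, rfl, rfl, h⟩ := ih hk
    -- Only a lift of the third term is extracted; `ih'` is kept whole, to relate this lift to the
    -- lift of the middle term already chosen.
    obtain ⟨j', z, rfl⟩ := (fun ⟨j, _, z, _, hz, _⟩ => ⟨j, z, hz⟩ :
      LiftEqv p (y.map (p j)) _ → ∃ j z, PreCell.map (p j) z = _) (ih' hk)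
    obtain ⟨m, f, e⟩ := (ih' hk).exists_eqv H hk (y.map (D.map (IsFiltered.leftToMax j j')))
      (z.map (D.map (IsFiltered.rightToMax j j'))) (H.map_w _ _) (H.map_w _ _)
    refine ⟨m, _, _, ?_, ?_, ((h.map (D.map (IsFiltered.leftToMax j j'))).map (D.map f)).trans e⟩
    all_goals simp only [H.map_w]
  | ident _ ih =>
    obtain ⟨j, x, y, rfl, rfl, h⟩ := ih (Nat.le_of_succ_le hk)
    exact ⟨j, _, _, rfl, rfl, h.ident⟩
  | @comp i k h x x' y y' _ _ _ _ ihx ihy ihxy ihxy' =>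
    have hi := h.le.trans hk
    obtain ⟨j₁, x, x', rfl, rfl, hx⟩ := ihx hk
    obtain ⟨j₂, y, y', rfl, rfl, hy⟩ := ihy hk
    have ⟨j, f₁, f₂, _⟩ := IsFilteredOrEmpty.cocone_objs j₁ j₂
    obtain ⟨m, g, e⟩ := (ihxy hi).exists_eqv H hi (faceTo true h.le (x.map (D.map f₁)))
      (faceTo false h.le (y.map (D.map f₂))) (by rw [map_faceTo, H.map_w])
      (by rw [map_faceTo, H.map_w])
    obtain ⟨m', g', e'⟩ := (ihxy' hi).exists_eqv H hi
      (faceTo true h.le ((x'.map (D.map f₁)).map (D.map g)))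
      (faceTo false h.le ((y'.map (D.map f₂)).map (D.map g)))
      (by rw [map_faceTo]; simp only [H.map_w]) (by rw [map_faceTo]; simp only [H.map_w])
    -- The first composability condition holds at `m` and is pushed to `m'`, where the second one
    -- holds.
    replace e := e.map (D.map g')
    simp only [map_faceTo] at e e'
    refine ⟨m', _, _, ?_, ?_, .comp h (((hx.map (D.map f₁)).map (D.map g)).map (D.map g'))
      (((hy.map (D.map f₂)).map (D.map g)).map (D.map g')) e e'⟩
    all_goals simp only [PreCell.map, H.map_w]
  | ax h _ _ ihx ihy =>
    obtain ⟨j, x, y, rfl, rfl, h'⟩ := H.exists_lift_ax hk h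
    obtain ⟨i, f, ex⟩ := (ihx hk).exists_eqv H hk x x rfl rfl
    obtain ⟨m, g, ey⟩ := (ihy hk).exists_eqv H hk (y.map (D.map f)) (y.map (D.map f))
      (H.map_w _ _) (H.map_w _ _)
    refine ⟨m, _, _, ?_, ?_, .ax ((h'.map (D.map f)).map (D.map g)) (ex.map _) ey⟩
    all_goals simp only [H.map_w]

theorem free (H : FilteredUpTo D p n) :
    FilteredUpTo (D ⋙ freeFunctor ⋙ StrictOmegaCat.forget)
      (fun j => StrictOmegaCat.forget.map (freeFunctor.map (p j))) n where
  w f := by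
    rw [Functor.comp_map, Functor.comp_map, ← Functor.map_comp, ← Functor.map_comp, H.w]
  surj {k} hk y := by
    obtain ⟨y, hy, rfl⟩ := FreeCell.exists_mk y
    obtain ⟨j, x, _, rfl, _, hx⟩ := H.liftEqv hk hy
    exact ⟨j, FreeCell.mk x hx.left, freeFunctor_map_mk (p j) hx.left⟩
  inj {k} hk j x y h := by
    obtain ⟨x, hx, rfl⟩ := FreeCell.exists_mk x
    obtain ⟨y, hy, rfl⟩ := FreeCell.exists_mk y
    have h' := (freeFunctor_map_mk (p j) hx).symm.trans (h.trans (freeFunctor_map_mk (p j) hy))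
    obtain ⟨i, f, e⟩ := (H.liftEqv hk (FreeCell.mk_eq_mk.1 h')).exists_eqv H hk x y rfl rfl
    exact ⟨i, f, (freeFunctor_map_mk (D.map f) hx).trans
      ((FreeCell.mk_eq_mk.2 e).trans (freeFunctor_map_mk (D.map f) hy).symm)⟩

end FilteredUpTo

/-! ### Filtered colimits of globular sets, computed elementwise -/

section Colimits

open Limits

variable {D : J ⥤ OmegaGlob.{u}}

theorem map_comp_apply (D : J ⥤ OmegaGlob.{u}) {i j m : J} (f : i ⟶ j) (g : j ⟶ m) {k : ℕ}
    (x : (D.obj i).cell k) :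
    (D.map (f ≫ g)).map k x = (D.map g).map k ((D.map f).map k x) := by
  rw [D.map_comp]
  rfl

theorem cocone_map_apply (s : Cocone D) {i j : J} (f : i ⟶ j) {k : ℕ} (x : (D.obj i).cell k) :
    (s.ι.app j).map k ((D.map f).map k x) = (s.ι.app i).map k x :=
  congrFun (congrFun (congrArg Hom.map (s.w f)) k) x

variable [IsFiltered J]

theorem FilteredUpTo.cocone_app_eq {c : Cocone D} (H : ∀ n, FilteredUpTo D c.ι.app n)
    (s : Cocone D) {k : ℕ} {i j : J} (x : (D.obj i).cell k) (y : (D.obj j).cell k)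
    (h : (c.ι.app i).map k x = (c.ι.app j).map k y) :
    (s.ι.app i).map k x = (s.ι.app j).map k y := by
  rw [← cocone_map_apply c (IsFiltered.leftToMax i j),
    ← cocone_map_apply c (IsFiltered.rightToMax i j)] at h
  obtain ⟨m, f, e⟩ := (H k).inj le_rfl _ _ h
  rw [← cocone_map_apply s (IsFiltered.leftToMax i j),
    ← cocone_map_apply s (IsFiltered.rightToMax i j), ← cocone_map_apply s f, e,
    cocone_map_apply s f]

/-- A cocone satisfying the elementwise characterization of filtered colimits is a colimit. -/
noncomputable def FilteredUpTo.isColimit {c : Cocone D} (H : ∀ n, FilteredUpTo D c.ι.app n) :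
    IsColimit c :=
  have key (s : Cocone D) (k : ℕ) (y : c.pt.cell k) :
      ∃ z : s.pt.cell k, ∀ j x, (c.ι.app j).map k x = y → (s.ι.app j).map k x = z := by
    obtain ⟨i, x, rfl⟩ := (H k).surj le_rfl y
    exact ⟨_, fun j x' h => cocone_app_eq H s _ _ h⟩
  { desc s :=
      { map := fun k y => (key s k y).choose
        map_src := fun {k} y => by
          obtain ⟨j, x, rfl⟩ := (H (k + 1)).surj le_rfl y
          rw [← (key s _ _).choose_spec j x rfl,
            ← (key s _ _).choose_spec j _ ((c.ι.app j).map_src x)]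
          exact (s.ι.app j).map_src x
        map_tgt := fun {k} y => by
          obtain ⟨j, x, rfl⟩ := (H (k + 1)).surj le_rfl y
          rw [← (key s _ _).choose_spec j x rfl,
            ← (key s _ _).choose_spec j _ ((c.ι.app j).map_tgt x)]
          exact (s.ι.app j).map_tgt x }
    fac s j := by
      apply Hom.ext
      funext k x
      exact ((key s _ _).choose_spec j x rfl).symm
    uniq s m hm := by
      apply Hom.ext
      funext k y
      obtain ⟨j, x, rfl⟩ := (H k).surj le_rfl y
      exact (congrFun (congrFun (congrArg Hom.map (hm j)) k) x).trans
        ((key s _ _).choose_spec j x rfl) }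

/-- Elements of a filtered diagram with the same image in the colimit. -/
def colimitSetoid (D : J ⥤ OmegaGlob.{u}) (k : ℕ) : Setoid (Σ j, (D.obj j).cell k) where
  r x y := ∃ (i : J) (f : x.1 ⟶ i) (g : y.1 ⟶ i), (D.map f).map k x.2 = (D.map g).map k y.2
  iseqv :=
    { refl := fun x => ⟨_, 𝟙 _, 𝟙 _, rfl⟩
      symm := fun ⟨i, f, g, h⟩ => ⟨i, g, f, h.symm⟩
      trans := fun ⟨i, f, g, h⟩ ⟨i', f', g', h'⟩ => by
        obtain ⟨m, a, b, e⟩ := IsFiltered.span g f'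
        refine ⟨m, f ≫ a, g' ≫ b, ?_⟩
        rw [map_comp_apply, h, ← map_comp_apply, e, map_comp_apply, h', ← map_comp_apply] }

/-- The elementwise colimit of a filtered diagram. -/
def colimitGlob (D : J ⥤ OmegaGlob.{u}) : OmegaGlob.{u} where
  cell k := Quotient (colimitSetoid D k)
  src {k} := Quotient.map (fun x => ⟨x.1, (D.obj x.1).src x.2⟩) fun _ _ ⟨i, f, g, h⟩ =>
    ⟨i, f, g, by rw [(D.map f).map_src, (D.map g).map_src, h]⟩
  tgt {k} := Quotient.map (fun x => ⟨x.1, (D.obj x.1).tgt x.2⟩) fun _ _ ⟨i, f, g, h⟩ =>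
    ⟨i, f, g, by rw [(D.map f).map_tgt, (D.map g).map_tgt, h]⟩
  src_src x := by
    obtain ⟨⟨j, x⟩, rfl⟩ := Quotient.exists_rep x
    exact congrArg (fun y => Quotient.mk (colimitSetoid D _) ⟨j, y⟩) ((D.obj j).src_src x)
  tgt_src x := by
    obtain ⟨⟨j, x⟩, rfl⟩ := Quotient.exists_rep x
    exact congrArg (fun y => Quotient.mk (colimitSetoid D _) ⟨j, y⟩) ((D.obj j).tgt_src x)

/-- The cocone of the elementwise colimit of a filtered diagram. -/
def colimitCocone (D : J ⥤ OmegaGlob.{u}) : Cocone D where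
  pt := colimitGlob D
  ι :=
    { app := fun j =>
        { map := fun _ x => Quotient.mk _ ⟨j, x⟩
          map_src := fun _ => rfl
          map_tgt := fun _ => rfl }
      naturality := fun i j f => by
        apply Hom.ext
        funext k x
        refine Quotient.sound ⟨j, 𝟙 j, f, ?_⟩
        change (D.map (𝟙 j)).map k ((D.map f).map k x) = _
        rw [← map_comp_apply, Category.comp_id] }

theorem filteredUpTo_colimitCocone (D : J ⥤ OmegaGlob.{u}) (n : ℕ) :
    FilteredUpTo D (colimitCocone D).ι.app n where
  w := (colimitCocone D).w
  surj _ y := by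
    obtain ⟨⟨j, x⟩, rfl⟩ := Quotient.exists_rep y
    exact ⟨j, x, rfl⟩
  inj {k} _ j x y h := by
    obtain ⟨i, f, g, e⟩ := Quotient.exact h
    refine ⟨_, f ≫ IsFiltered.coeqHom f g, ?_⟩
    rw [map_comp_apply, e, ← map_comp_apply, IsFiltered.coeq_condition]

/-- The property is known for the explicit colimit and travels along the comparison isomorphism of
colimit cocones. -/
theorem filteredUpTo_of_isColimit {c : Cocone D} (hc : IsColimit c) (n : ℕ) :
    FilteredUpTo D c.ι.app n := by
  have hE : IsColimit (colimitCocone D) :=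
    FilteredUpTo.isColimit (filteredUpTo_colimitCocone D)
  have H := filteredUpTo_colimitCocone D n
  let e := hc.coconePointUniqueUpToIso hE
  have he (j : J) (k : ℕ) (x : (D.obj j).cell k) :
      e.hom.map k ((c.ι.app j).map k x) = ((colimitCocone D).ι.app j).map k x :=
    congrFun (congrFun (congrArg Hom.map
      (IsColimit.comp_coconePointUniqueUpToIso_hom hc hE j)) k) x
  have hinj (k : ℕ) (x y : c.pt.cell k) (h : e.hom.map k x = e.hom.map k y) : x = y := by
    have hid (z : c.pt.cell k) : e.inv.map k (e.hom.map k z) = z :=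
      congrFun (congrFun (congrArg Hom.map e.hom_inv_id) k) z
    rw [← hid x, h, hid]
  refine ⟨fun f => c.w f, fun {k} hk y => ?_, fun {k} hk j x y h => ?_⟩
  · obtain ⟨j, x, h⟩ := H.surj hk (e.hom.map k y)
    exact ⟨j, x, hinj k _ _ ((he j k x).trans h)⟩
  · refine H.inj hk x y ?_
    rw [← he, ← he, h]

theorem preservesFilteredColimits_free :
    PreservesFilteredColimits (freeFunctor.{u} ⋙ StrictOmegaCat.forget) where
  preserves_filtered_colimits _ _ _ :=
    ⟨fun {_} => ⟨fun hc => ⟨FilteredUpTo.isColimit fun n => (filteredUpTo_of_isColimit hc n).free⟩⟩⟩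

end Colimits

/-! ### Truncation as a one-object filtered diagram -/

theorem filteredUpTo_counit (X : OmegaGlob.{u}) (n : ℕ) :
    FilteredUpTo ((Functor.const (Discrete PUnit.{u + 1})).obj ((incl n).obj ((trunc n).obj X)))
      (fun _ => (inclTruncAdj n).counit.app X) n where
  w _ := Category.id_comp _
  surj hk y := ⟨⟨⟨⟩⟩, ⟨hk, y⟩, rfl⟩
  inj _ j x y h := by
    refine ⟨j, 𝟙 j, ?_⟩
    obtain ⟨_, x⟩ := x
    obtain ⟨_, y⟩ := y
    obtain rfl : x = y := h
    rfl

theorem free_counit_bijective (X : OmegaGlob.{u}) {k n : ℕ} (hk : k ≤ n) :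
    Function.Bijective ((StrictOmegaCat.forget.map
      (freeFunctor.map ((inclTruncAdj n).counit.app X))).map k) := by
  have : IsFiltered (Discrete PUnit.{u + 1}) := inferInstance
  have H := (filteredUpTo_counit X n).free
  constructor
  · intro x y h
    obtain ⟨i, f, e⟩ := H.inj hk (j := ⟨⟨⟩⟩) x y h
    -- The transition map in `e` is the image of an identity under two functors, so it has to be
    -- recognised as an identity before `x = y` can be read off.
    have hid : StrictOmegaCat.forget.map (freeFunctor.map (𝟙 ((incl n).obj ((trunc n).obj X)))) =
        𝟙 _ := by
      rw [CategoryTheory.Functor.map_id, CategoryTheory.Functor.map_id]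
    have key (z) := congrFun (congrFun (congrArg Hom.map hid) k) z
    exact (key x).symm.trans (e.trans (key y))
  · intro y
    obtain ⟨_, x, h⟩ := H.surj hk y
    exact ⟨x, h⟩

end OmegaGlob

/-! ### Isomorphisms of finite globular sets and the main theorem -/

theorem FinGlob.isIso_of_bijective {n : ℕ} {X Y : FinGlob.{u} n} (f : X ⟶ Y)
    (hf : ∀ (k : ℕ) (h : k ≤ n), Function.Bijective (f.map k h)) : IsIso f := by
  let e (k : ℕ) (h : k ≤ n) := Equiv.ofBijective _ (hf k h)
  have he (k : ℕ) (h : k ≤ n) (y : Y.cell k h) : f.map k h ((e k h).symm y) = y :=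
    (e k h).apply_symm_apply y
  let g : FinGlob.Hom Y X :=
    { map := fun k h => (e k h).symm
      map_src := fun h y => (hf _ _).1 (by rw [he, f.map_src, he])
      map_tgt := fun h y => (hf _ _).1 (by rw [he, f.map_tgt, he]) }
  refine ⟨g, ?_, ?_⟩
  · apply FinGlob.Hom.ext
    funext k h x
    exact (e k h).symm_apply_apply x
  · apply FinGlob.Hom.ext
    funext k h y
    exact he k h y

theorem mainTheorem7 :
    StrictOmegaCat.forget.{u}.IsRightAdjoint ∧
      ∀ (F : OmegaGlob.{u} ⥤ StrictOmegaCat.{u}) (adj : F ⊣ StrictOmegaCat.forget.{u}),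
        OmegaGlob.IsFinitary adj.toMonad ∧ OmegaGlob.IsWeaklyTruncable adj.toMonad := by
  refine ⟨OmegaGlob.freeAdj.isRightAdjoint, fun F adj => ?_⟩
  let e : OmegaGlob.freeFunctor ⋙ StrictOmegaCat.forget ≅ F ⋙ StrictOmegaCat.forget :=
    Functor.isoWhiskerRight (OmegaGlob.freeAdj.leftAdjointUniq adj) _
  refine ⟨⟨fun J _ _ => ?_⟩, fun n => ?_⟩
  · have := OmegaGlob.preservesFilteredColimits_free.{u}.preserves_filtered_colimits J
    exact Limits.preservesColimitsOfShape_of_natIso e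
  · rw [NatTrans.isIso_iff_isIso_app]
    intro X
    let t := (OmegaGlob.inclTruncAdj n).counit.app X
    have h₀ : IsIso ((OmegaGlob.trunc n).map
        ((OmegaGlob.freeFunctor ⋙ StrictOmegaCat.forget).map t)) :=
      FinGlob.isIso_of_bijective _ fun k hk => OmegaGlob.free_counit_bijective X hk
    -- By naturality of `e`, the comparison map for `F` is the one for the free functor conjugated
    -- by isomorphisms.
    have h₁ : (F ⋙ StrictOmegaCat.forget).map t =
        e.inv.app _ ≫ (OmegaGlob.freeFunctor ⋙ StrictOmegaCat.forget).map t ≫ e.hom.app _ := by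
      rw [e.hom.naturality, Iso.inv_hom_id_app_assoc]
    have h₂ : IsIso ((OmegaGlob.trunc n).map ((F ⋙ StrictOmegaCat.forget).map t)) := by
      rw [h₁, Functor.map_comp, Functor.map_comp]
      infer_instance
    exact h₂
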